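/- \textbf{Lemma (Conditional Worst Additive Noise Lemma).} Let $n\ge 1$ and let $X^n=(X_1,\dots,X_n)$ and $U^n=(U_1,\dots,U_n)$ be real random sequences on a common probability space, with an arbitrary joint law, each satisfying an average power constraint $\frac1n\sum_{j=1}^n\mathbb{E}[X_j^2]\le P_X<\infty$, $\frac1n\sum_{j=1}^n\mathbb{E}[U_j^2]\le P_U<\infty$. Let $Z^n=(Z_1,\dots,Z_n)$ be i.i.d. $\mathcal N(0,\sigma_Z^2)$, $\sigma_Z^2\ge 0$, and independent of the pair $(X^n,U^n)$. Let $K$ be a real $3\times 3$ matrix with $$\frac1n\sum_{j=1}^n \mathrm{Cov}(Z_j,\,X_j+Z_j,\,U_j)\preceq K ,$$ where $\mathrm{Cov}(\cdot)$ is the (centered) covariance matrix and $\preceq$ is the order given by positive semidefinite differences. Let $(Z,X_g+Z,U_g)$ be a zero-mean Gaussian random vector with covariance matrix $K$, where $Z\sim\mathcal N(0,\sigma_Z^2)$ has the law of the noise (so that $K_{11}=\sigma_Z^2$). For a random vector $A$ and a random variable or vector $B$ write $h(A|B)=-\mathbb E[\log p(A|B)]\in[-\infty,\infty)$ for the conditional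 differential entropy, where $p(a|b)$ is the conditional Lebesgue density of $A$ given $B$, and $h(A|B)=-\infty$ if there is no such density. Then $h(X^n|U^n)$, $h(X^n+Z^n|U^n)$, $h(X_g|U_g)$ and $h(X_g+Z|U_g)$ are all $<\infty$, the second and the fourth are finite if $\sigma_Z^2>0$, and $$h(X^n|U^n)-h(X^n+Z^n|U^n)\;\le\; n\,h(X_g|U_g)-n\,h(X_g+Z|U_g).$$ Equality holds if the pairs $(X_j,U_j)$, $j=1,\dots,n$, are i.i.d. copies of $(X_g,U_g)$. (If $\sigma_Z^2=0$, a difference $(-\infty)-(-\infty)$ is read as $-\infty$.) -/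

import Mathlib

open MeasureTheory ProbabilityTheory
open scoped NNReal ENNReal

/-- The density `p(x | u)` of `X` given `U` with respect to Lebesgue measure (the measure `volume`
of the space `E` of values of `X`), as a function of the pair `(u, x)`: the density of the joint
law of `(U, X)` with respect to the product of the law of `U` with Lebesgue measure.
It makes sense for an arbitrary law of `U`. -/
noncomputable def condDensity {Ω E F : Type*} [MeasurableSpace Ω] [MeasureSpace E]
    [MeasurableSpace F] (X : Ω → E) (U : Ω → F) (μ : Measure Ω) : F × E → ℝ≥0∞ :=
  (μ.map (fun ω => (U ω, X ω))).rnDeriv ((μ.map U).prod (volume : Measure E))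

/-- The conditional differential entropy `h(X | U) = - E[log p(X | U)]` in nats, as an extended
real number: the expectation of the positive part of `- log p(X | U)` minus the expectation of its
negative part, and `-∞` if `X` has no conditional density given `U`. -/
noncomputable def condDiffEntropy {Ω E F : Type*} [MeasurableSpace Ω] [MeasureSpace E]
    [MeasurableSpace F] (X : Ω → E) (U : Ω → F) (μ : Measure Ω) : EReal :=
  open Classical in
  if (μ.map (fun ω => (U ω, X ω))) ≪ (μ.map U).prod (volume : Measure E) then
    ((∫⁻ p, ENNReal.ofReal (-Real.log (condDensity X U μ p).toReal)
        ∂(μ.map (fun ω => (U ω, X ω))) : ℝ≥0∞) : EReal)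
      - ((∫⁻ p, ENNReal.ofReal (Real.log (condDensity X U μ p).toReal)
        ∂(μ.map (fun ω => (U ω, X ω))) : ℝ≥0∞) : EReal)
  else ⊥

/-- The random sequence `X^n` obeys the average power constraint `(1/n) ∑ⱼ E[Xⱼ²] ≤ P`. -/
def AvgPowerConstraint {Ω : Type*} [MeasurableSpace Ω] {n : ℕ} (X : Ω → Fin n → ℝ) (P : ℝ≥0)
    (μ : Measure Ω) : Prop :=
  ∑ j, ∫⁻ ω, ENNReal.ofReal (X ω j ^ 2) ∂μ ≤ (n : ℝ≥0∞) * (P : ℝ≥0∞)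

/-- The covariance matrix of a random vector. -/
noncomputable def covarianceMatrix {Ω ι : Type*} [MeasurableSpace Ω] (V : Ω → ι → ℝ)
    (μ : Measure Ω) : Matrix ι ι ℝ :=
  Matrix.of fun i k => covariance (fun ω => V ω i) (fun ω => V ω k) μ

/-!
The difference `h(X + Z | U) - h(X | U)` is the conditional mutual information of `Z` and `X + Z`
given `U`, so it is at least `E[log r(U, X + Z, Z)]` for every `r` with `∫ r(u, y, z) dP_Z(z) ≤ 1`.
Indeed `h(X | U) = h(X | U, Z)` because `Z` is independent of `(X, U)`, and by Gibbs' inequality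
this is at most the cross entropy against `q(u, x + z) r(u, x + z, z)`, where `q` is the density of
`X + Z` given `U`; the factor `q` contributes `h(X + Z | U)`.

Take for `r` the likelihood ratio `φ_v(y - z - m(u)) / φ_{v + σ²}(y - m(u))` of the Gaussian model,
where `m(u) = a u + b` is the regression of `X_g` on `U_g` and `v` its residual variance. The bound
then depends on `X` and `U` only through the residual variances of `X_j - a U_j`, and it is
`n h(X_g | U_g) - n h(X_g + Z | U_g)` when these add up to at most `n v`.

The diagonal entry `K₁₁ = σ²` forces the whole first column of `K - (1/n) ∑ Cov` to vanish, so that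
`Z_g` is uncorrelated with, hence independent of, `(X_g, U_g)`; the quadratic form of the covariance
constraint at `(-1, 1, -a)` bounds the residual variances. In the case of equality, `X` given `U`
is a translate of a product of Gaussians, whose entropy is additive.
-/

section SignedParts

variable {Ω : Type*} [MeasurableSpace Ω] {μ : Measure Ω} {g : Ω → ℝ}

theorem lintegral_ofReal_neg_sub_lintegral_ofReal (hg : Integrable g μ) :
    ((∫⁻ ω, ENNReal.ofReal (-g ω) ∂μ : ℝ≥0∞) : EReal) - (∫⁻ ω, ENNReal.ofReal (g ω) ∂μ : ℝ≥0∞)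
      = ((-∫ ω, g ω ∂μ : ℝ) : EReal) := by
  have hpos : ∫⁻ ω, ENNReal.ofReal (g ω) ∂μ ≠ ∞ := hg.lintegral_lt_top.ne
  have hneg : ∫⁻ ω, ENNReal.ofReal (-g ω) ∂μ ≠ ∞ := hg.neg.lintegral_lt_top.ne
  rw [integral_eq_lintegral_pos_part_sub_lintegral_neg_part hg, neg_sub, EReal.coe_sub,
    EReal.coe_ennreal_toReal hneg, EReal.coe_ennreal_toReal hpos]

theorem integrable_of_lintegral_ofReal_ne_top (hg : AEStronglyMeasurable g μ)
    (hpos : ∫⁻ ω, ENNReal.ofReal (g ω) ∂μ ≠ ∞) (hneg : ∫⁻ ω, ENNReal.ofReal (-g ω) ∂μ ≠ ∞) :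
    Integrable g μ := by
  refine ⟨hg, (hasFiniteIntegral_iff_norm _).2 ?_⟩
  calc ∫⁻ ω, ENNReal.ofReal ‖g ω‖ ∂μ
      ≤ ∫⁻ ω, (ENNReal.ofReal (g ω) + ENNReal.ofReal (-g ω)) ∂μ := by
        refine lintegral_mono fun ω => ?_
        rcases le_total 0 (g ω) with h | h
        · simp [abs_of_nonneg h]
        · simp [abs_of_nonpos h]
    _ < ∞ := by
        rw [lintegral_add_left' hg.aemeasurable.ennreal_ofReal]
        exact ENNReal.add_lt_top.2 ⟨hpos.lt_top, hneg.lt_top⟩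

end SignedParts

section CondDensity

variable {Ω E F : Type*} [MeasurableSpace Ω] [MeasureSpace E] [MeasurableSpace F]

/-- `f` is a version of the conditional density `p(x | u)` of `X` given `U`: the joint law of
`(U, X)` has density `f` with respect to the product of the law of `U` with Lebesgue measure. -/
structure HasCondDensity (f : F × E → ℝ≥0∞) (X : Ω → E) (U : Ω → F) (μ : Measure Ω) : Prop where
  aemeasurable_fst : AEMeasurable X μ
  aemeasurable_snd : AEMeasurable U μ
  measurable : Measurable f
  map_eq : μ.map (fun ω => (U ω, X ω)) = ((μ.map U).prod (volume : Measure E)).withDensity f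

variable {μ : Measure Ω} {X X' : Ω → E} {U U' : Ω → F} {f : F × E → ℝ≥0∞}

theorem condDiffEntropy_congr (hX : X =ᵐ[μ] X') (hU : U =ᵐ[μ] U') :
    condDiffEntropy X U μ = condDiffEntropy X' U' μ := by
  have hmap : μ.map (fun ω => (U ω, X ω)) = μ.map (fun ω => (U' ω, X' ω)) :=
    Measure.map_congr (by filter_upwards [hX, hU] with ω h₁ h₂; rw [h₁, h₂])
  rw [condDiffEntropy, condDiffEntropy, condDensity, condDensity, hmap, Measure.map_congr hU]

theorem condDiffEntropy_eq_bot
    (h : ¬ μ.map (fun ω => (U ω, X ω)) ≪ (μ.map U).prod (volume : Measure E)) :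
    condDiffEntropy X U μ = ⊥ :=
  if_neg h

namespace HasCondDensity

theorem ae_of_ae_prod (h : HasCondDensity f X U μ) {P : F × E → Prop}
    (hP : ∀ᵐ p ∂(μ.map U).prod (volume : Measure E), f p ≠ 0 → P p) :
    ∀ᵐ ω ∂μ, P (U ω, X ω) := by
  refine ae_of_ae_map (h.aemeasurable_snd.prodMk h.aemeasurable_fst) ?_
  rw [h.map_eq]
  exact (ae_withDensity_iff h.measurable).2 hP

theorem ae_ne_zero (h : HasCondDensity f X U μ) : ∀ᵐ ω ∂μ, f (U ω, X ω) ≠ 0 :=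
  h.ae_of_ae_prod (.of_forall fun _ hp => hp)

theorem lintegral_eq (h : HasCondDensity f X U μ) :
    ∫⁻ p, f p ∂(μ.map U).prod (volume : Measure E) = μ .univ := by
  rw [← setLIntegral_univ, ← withDensity_apply _ .univ, ← h.map_eq,
    Measure.map_apply_of_aemeasurable (h.aemeasurable_snd.prodMk h.aemeasurable_fst) .univ,
    Set.preimage_univ]

theorem aemeasurable_log (h : HasCondDensity f X U μ) :
    AEMeasurable (fun ω => Real.log (f (U ω, X ω)).toReal) μ :=
  (h.measurable.comp_aemeasurable (h.aemeasurable_snd.prodMk h.aemeasurable_fst)).ennreal_toReal.log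

variable [IsFiniteMeasure μ]

theorem ae_ne_top (h : HasCondDensity f X U μ) : ∀ᵐ ω ∂μ, f (U ω, X ω) ≠ ∞ := by
  refine h.ae_of_ae_prod ((ae_lt_top h.measurable ?_).mono fun p hp _ => hp.ne)
  exact h.lintegral_eq ▸ measure_ne_top μ _

variable [SigmaFinite (volume : Measure E)]

theorem condDiffEntropy_eq (h : HasCondDensity f X U μ) :
    condDiffEntropy X U μ =
      ((∫⁻ ω, ENNReal.ofReal (-Real.log (f (U ω, X ω)).toReal) ∂μ : ℝ≥0∞) : EReal)
        - ((∫⁻ ω, ENNReal.ofReal (Real.log (f (U ω, X ω)).toReal) ∂μ : ℝ≥0∞) : EReal) := by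
  have hUX := h.aemeasurable_snd.prodMk h.aemeasurable_fst
  have hac : μ.map (fun ω => (U ω, X ω)) ≪ (μ.map U).prod (volume : Measure E) :=
    h.map_eq ▸ withDensity_absolutelyContinuous _ _
  have hf : condDensity X U μ =ᵐ[μ.map fun ω => (U ω, X ω)] f := by
    refine hac.ae_eq ?_
    rw [condDensity, h.map_eq]
    exact Measure.rnDeriv_withDensity _ h.measurable
  have transfer (φ : ℝ≥0∞ → ℝ≥0∞) (hφ : Measurable φ) :
      ∫⁻ p, φ (condDensity X U μ p) ∂μ.map (fun ω => (U ω, X ω)) = ∫⁻ ω, φ (f (U ω, X ω)) ∂μ :=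
    (lintegral_congr_ae (hf.fun_comp φ)).trans
      (lintegral_map' (hφ.comp h.measurable).aemeasurable hUX)
  rw [condDiffEntropy, if_pos hac,
    transfer (fun y => ENNReal.ofReal (-Real.log y.toReal)) (by fun_prop),
    transfer (fun y => ENNReal.ofReal (Real.log y.toReal)) (by fun_prop)]

theorem condDiffEntropy_eq_neg_integral (h : HasCondDensity f X U μ)
    (hi : Integrable (fun ω => Real.log (f (U ω, X ω)).toReal) μ) :
    condDiffEntropy X U μ = ((-∫ ω, Real.log (f (U ω, X ω)).toReal ∂μ : ℝ) : EReal) := by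
  rw [h.condDiffEntropy_eq, lintegral_ofReal_neg_sub_lintegral_ofReal hi]

theorem integrable_log (h : HasCondDensity f X U μ) (hbot : condDiffEntropy X U μ ≠ ⊥)
    (htop : condDiffEntropy X U μ ≠ ⊤) :
    Integrable (fun ω => Real.log (f (U ω, X ω)).toReal) μ := by
  rw [h.condDiffEntropy_eq] at hbot htop
  have hpos : ∫⁻ ω, ENNReal.ofReal (Real.log (f (U ω, X ω)).toReal) ∂μ ≠ ∞ := fun hinf =>
    hbot (by rw [hinf, EReal.coe_ennreal_top, EReal.sub_top])
  refine integrable_of_lintegral_ofReal_ne_top h.aemeasurable_log.aestronglyMeasurable hpos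
    fun hinf => htop ?_
  rw [hinf, EReal.coe_ennreal_top, EReal.top_sub (by simpa using hpos)]

theorem condDiffEntropy_le_integral (h : HasCondDensity f X U μ) {b : Ω → ℝ}
    (hb : Integrable b μ) (hle : ∀ᵐ ω ∂μ, -Real.log (f (U ω, X ω)).toReal ≤ b ω) :
    condDiffEntropy X U μ ≤ ((∫ ω, b ω ∂μ : ℝ) : EReal) := by
  rcases eq_or_ne (∫⁻ ω, ENNReal.ofReal (Real.log (f (U ω, X ω)).toReal) ∂μ) ∞ with hpos | hpos
  · simp [h.condDiffEntropy_eq, hpos]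
  have hneg : ∫⁻ ω, ENNReal.ofReal (-Real.log (f (U ω, X ω)).toReal) ∂μ ≠ ∞ :=
    ((lintegral_mono_ae (hle.mono fun ω => ENNReal.ofReal_le_ofReal)).trans_lt
      hb.lintegral_lt_top).ne
  have hi := integrable_of_lintegral_ofReal_ne_top h.aemeasurable_log.aestronglyMeasurable
    hpos hneg
  rw [h.condDiffEntropy_eq_neg_integral hi, EReal.coe_le_coe_iff, ← integral_neg]
  exact integral_mono_ae hi.neg hb hle

end HasCondDensity

theorem hasCondDensity_condDensity [IsFiniteMeasure μ] [SigmaFinite (volume : Measure E)]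
    (hX : AEMeasurable X μ) (hU : AEMeasurable U μ)
    (h : μ.map (fun ω => (U ω, X ω)) ≪ (μ.map U).prod (volume : Measure E)) :
    HasCondDensity (condDensity X U μ) X U μ where
  aemeasurable_fst := hX
  aemeasurable_snd := hU
  measurable := Measure.measurable_rnDeriv _ _
  map_eq := (Measure.withDensity_rnDeriv_eq _ _ h).symm

end CondDensity

section Gibbs

theorem neg_log_toReal_le {x y : ℝ≥0∞} (hx0 : x ≠ 0) (hx : x ≠ ∞) (hy0 : y ≠ 0) (hy : y ≠ ∞) :
    -Real.log x.toReal ≤ (y / x).toReal - 1 - Real.log y.toReal := by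
  have hx' := ENNReal.toReal_pos hx0 hx
  have hy' := ENNReal.toReal_pos hy0 hy
  have hlog := Real.log_le_sub_one_of_pos (div_pos hy' hx')
  rw [Real.log_div hy'.ne' hx'.ne', ← ENNReal.toReal_div] at hlog
  linarith

variable {Ω E F : Type*} [MeasurableSpace Ω] [MeasureSpace E] [MeasurableSpace F]
  {μ : Measure Ω} {X : Ω → E} {U : Ω → F} {f g : F × E → ℝ≥0∞}

theorem HasCondDensity.lintegral_div_le (h : HasCondDensity f X U μ) (hg : Measurable g) :
    ∫⁻ ω, g (U ω, X ω) / f (U ω, X ω) ∂μ ≤ ∫⁻ p, g p ∂(μ.map U).prod (volume : Measure E) := by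
  rw [← lintegral_map' (f := fun p => g p / f p) (hg.div h.measurable).aemeasurable
    (h.aemeasurable_snd.prodMk h.aemeasurable_fst), h.map_eq,
    lintegral_withDensity_eq_lintegral_mul _ h.measurable (g := fun p => g p / f p)
      (hg.div h.measurable)]
  exact lintegral_mono fun p => ENNReal.mul_div_le

variable [IsProbabilityMeasure μ] [SigmaFinite (volume : Measure E)]

theorem condDiffEntropy_le_neg_integral_log (hX : AEMeasurable X μ) (hU : AEMeasurable U μ)
    (hg : Measurable g) (hg0 : ∀ᵐ ω ∂μ, g (U ω, X ω) ≠ 0)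
    (hg1 : ∫⁻ p, g p ∂(μ.map U).prod (volume : Measure E) ≤ 1)
    (hi : Integrable (fun ω => Real.log (g (U ω, X ω)).toReal) μ) :
    condDiffEntropy X U μ ≤ ((-∫ ω, Real.log (g (U ω, X ω)).toReal ∂μ : ℝ) : EReal) := by
  by_cases hac : μ.map (fun ω => (U ω, X ω)) ≪ (μ.map U).prod (volume : Measure E)
  swap
  · exact condDiffEntropy_eq_bot hac ▸ bot_le
  set f := condDensity X U μ
  have h : HasCondDensity f X U μ := hasCondDensity_condDensity hX hU hac
  have hg_top : ∀ᵐ ω ∂μ, g (U ω, X ω) ≠ ∞ :=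
    h.ae_of_ae_prod ((ae_lt_top hg (hg1.trans_lt ENNReal.one_lt_top).ne).mono fun p hp _ => hp.ne)
  have hratio : ∫⁻ ω, g (U ω, X ω) / f (U ω, X ω) ∂μ ≤ 1 := (h.lintegral_div_le hg).trans hg1
  have hratio_meas : AEMeasurable (fun ω => g (U ω, X ω) / f (U ω, X ω)) μ :=
    (hg.div h.measurable).comp_aemeasurable (hU.prodMk hX)
  have hratio_ne_top := (hratio.trans_lt ENNReal.one_lt_top).ne
  have hratio_int := integrable_toReal_of_lintegral_ne_top hratio_meas hratio_ne_top
  have hratio_le : ∫ ω, (g (U ω, X ω) / f (U ω, X ω)).toReal ∂μ ≤ 1 := by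
    rw [integral_toReal hratio_meas (ae_lt_top' hratio_meas hratio_ne_top)]
    exact ENNReal.toReal_le_of_le_ofReal zero_le_one (by simpa using hratio)
  have hle : ∀ᵐ ω ∂μ, -Real.log (f (U ω, X ω)).toReal ≤
      (g (U ω, X ω) / f (U ω, X ω)).toReal - 1 - Real.log (g (U ω, X ω)).toReal := by
    filter_upwards [h.ae_ne_zero, h.ae_ne_top, hg0, hg_top] with ω using neg_log_toReal_le
  have hsub_int : Integrable (fun ω => (g (U ω, X ω) / f (U ω, X ω)).toReal - 1) μ :=
    hratio_int.sub (integrable_const 1)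
  refine (h.condDiffEntropy_le_integral (hsub_int.sub hi) hle).trans (EReal.coe_le_coe_iff.2 ?_)
  simp only [Pi.sub_apply]
  rw [integral_sub hsub_int hi, integral_sub hratio_int (integrable_const 1), integral_const,
    probReal_univ, one_smul]
  linarith

end Gibbs

section BoundedDensity

variable {Ω E F : Type*} [MeasurableSpace Ω] [MeasureSpace E] [MeasurableSpace F]
  [SigmaFinite (volume : Measure E)] {μ : Measure Ω} [IsFiniteMeasure μ]
  {X : Ω → E} {U : Ω → F} {C : ℝ≥0∞}

theorem condDensity_le_of_map_le_smul
    (h : μ.map (fun ω => (U ω, X ω)) ≤ C • (μ.map U).prod (volume : Measure E)) :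
    ∀ᵐ p ∂(μ.map U).prod (volume : Measure E), condDensity X U μ p ≤ C := by
  refine ae_le_of_forall_setLIntegral_le_of_sigmaFinite (Measure.measurable_rnDeriv _ _)
    fun s _ _ => ?_
  calc _ ≤ μ.map (fun ω => (U ω, X ω)) s := Measure.setLIntegral_rnDeriv_le s
    _ ≤ (C • (μ.map U).prod (volume : Measure E)) s := h s
    _ = _ := by simp

theorem bot_lt_condDiffEntropy_of_map_le_smul (hX : AEMeasurable X μ) (hU : AEMeasurable U μ)
    (hC : C ≠ ∞) (h : μ.map (fun ω => (U ω, X ω)) ≤ C • (μ.map U).prod (volume : Measure E)) :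
    ⊥ < condDiffEntropy X U μ := by
  have hf := hasCondDensity_condDensity hX hU (Measure.absolutelyContinuous_of_le_smul h)
  have hpos : ∫⁻ ω, ENNReal.ofReal (Real.log (condDensity X U μ (U ω, X ω)).toReal) ∂μ ≠ ∞ := by
    refine ne_top_of_le_ne_top (lintegral_const_lt_top (μ := μ) hC).ne (lintegral_mono_ae ?_)
    filter_upwards [hf.ae_of_ae_prod ((condDensity_le_of_map_le_smul h).mono fun p hp _ => hp)]
      with ω hω
    exact (ENNReal.ofReal_le_ofReal (Real.log_le_self ENNReal.toReal_nonneg)).trans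
      (ENNReal.ofReal_toReal_le.trans hω)
  rw [hf.condDiffEntropy_eq]
  refine lt_of_lt_of_le ?_ (EReal.sub_le_sub (EReal.coe_ennreal_nonneg _) le_rfl)
  rw [zero_sub, ← EReal.coe_ennreal_toReal hpos, ← EReal.coe_neg]
  exact EReal.bot_lt_coe _

end BoundedDensity

section Independence

variable {Ω α β : Type*} [MeasurableSpace Ω] [MeasurableSpace α] [MeasurableSpace β]
  {μ : Measure Ω} [IsFiniteMeasure μ]

theorem lintegral_comp_prodMk_of_indepFun {A : Ω → α} {B : Ω → β} (hA : AEMeasurable A μ)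
    (hB : AEMeasurable B μ) (hind : IndepFun A B μ) {φ : α × β → ℝ≥0∞} (hφ : Measurable φ) :
    ∫⁻ ω, φ (A ω, B ω) ∂μ = ∫⁻ ω, ∫⁻ b, φ (A ω, b) ∂μ.map B ∂μ := by
  rw [← lintegral_map' hφ.aemeasurable (hA.prodMk hB),
    (indepFun_iff_map_prod_eq_prod_map_map hA hB).1 hind, lintegral_prod _ hφ.aemeasurable,
    lintegral_map' hφ.lintegral_prod_right'.aemeasurable hA]

end Independence

section CondDensityComp

variable {Ω E F G : Type*} [MeasurableSpace Ω] [MeasureSpace E] [MeasurableSpace F]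
  [MeasurableSpace G] [SigmaFinite (volume : Measure E)] {μ : Measure Ω}
  {X : Ω → E} {U : Ω → F} {f : F × E → ℝ≥0∞}

theorem HasCondDensity.lintegral_comp (h : HasCondDensity f X U μ) {φ : F × E → ℝ≥0∞}
    (hφ : Measurable φ) :
    ∫⁻ ω, φ (U ω, X ω) ∂μ = ∫⁻ ω, (∫⁻ x, f (U ω, x) * φ (U ω, x)) ∂μ := by
  have hfφ := h.measurable.mul hφ
  rw [← lintegral_map' hφ.aemeasurable (h.aemeasurable_snd.prodMk h.aemeasurable_fst), h.map_eq,
    lintegral_withDensity_eq_lintegral_mul _ h.measurable hφ, lintegral_prod _ hfφ.aemeasurable,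
    lintegral_map' hfφ.lintegral_prod_right'.aemeasurable h.aemeasurable_snd]
  rfl

theorem HasCondDensity.of_lintegral_comp (hX : AEMeasurable X μ) (hU : AEMeasurable U μ)
    (hf : Measurable f) (h : ∀ φ : F × E → ℝ≥0∞, Measurable φ →
      ∫⁻ ω, φ (U ω, X ω) ∂μ = ∫⁻ ω, (∫⁻ x, f (U ω, x) * φ (U ω, x)) ∂μ) :
    HasCondDensity f X U μ where
  aemeasurable_fst := hX
  aemeasurable_snd := hU
  measurable := hf
  map_eq := Measure.ext_of_lintegral _ fun φ hφ => by
    have hfφ := hf.mul hφ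
    rw [lintegral_map' hφ.aemeasurable (hU.prodMk hX), h φ hφ,
      lintegral_withDensity_eq_lintegral_mul _ hf hφ, lintegral_prod _ hfφ.aemeasurable,
      lintegral_map' hfφ.lintegral_prod_right'.aemeasurable hU]
    rfl

variable [IsFiniteMeasure μ]

theorem HasCondDensity.prodMk_of_indepFun (h : HasCondDensity f X U μ) {Z : Ω → G}
    (hZ : AEMeasurable Z μ) (hind : IndepFun Z (fun ω => (X ω, U ω)) μ) :
    HasCondDensity (fun p : (F × G) × E => f (p.1.1, p.2)) X (fun ω => (U ω, Z ω)) μ := by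
  have hX := h.aemeasurable_fst
  have hU := h.aemeasurable_snd
  have hf := h.measurable
  refine .of_lintegral_comp hX (hU.prodMk hZ) (by fun_prop) fun φ hφ => ?_
  calc ∫⁻ ω, φ ((U ω, Z ω), X ω) ∂μ
      = ∫⁻ ω, ∫⁻ z, φ ((U ω, z), X ω) ∂μ.map Z ∂μ :=
        lintegral_comp_prodMk_of_indepFun (φ := fun p => φ ((p.1.2, p.2), p.1.1))
          (hX.prodMk hU) hZ hind.symm (by fun_prop)
    _ = ∫⁻ ω, (∫⁻ x, f (U ω, x) * ∫⁻ z, φ ((U ω, z), x) ∂μ.map Z) ∂μ :=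
        h.lintegral_comp (φ := fun p => ∫⁻ z, φ ((p.1, z), p.2) ∂μ.map Z)
          (Measurable.lintegral_prod_right' (f := fun q : (F × E) × G => φ ((q.1.1, q.2), q.1.2))
            (by fun_prop))
    _ = ∫⁻ ω, ∫⁻ z, (∫⁻ x, f (U ω, x) * φ ((U ω, z), x)) ∂μ.map Z ∂μ := by
        refine lintegral_congr fun ω => ?_
        rw [← lintegral_lintegral_swap (f := fun x z => f (U ω, x) * φ ((U ω, z), x))
          (by simp only [Function.uncurry_def]; fun_prop)]
        exact lintegral_congr fun x => (lintegral_const_mul _ (by fun_prop)).symm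
    _ = ∫⁻ ω, (∫⁻ x, f (U ω, x) * φ ((U ω, Z ω), x)) ∂μ :=
        (lintegral_comp_prodMk_of_indepFun
          (φ := fun p => ∫⁻ x, f (p.1, x) * φ ((p.1, p.2), x)) hU hZ
          (hind.symm.comp measurable_snd measurable_id)
          (Measurable.lintegral_prod_right'
            (f := fun q : (F × G) × E => f (q.1.1, q.2) * φ (q.1, q.2)) (by fun_prop))).symm

end CondDensityComp

section Singular

variable {Ω E F : Type*} [MeasurableSpace Ω] [MeasureSpace E] [MeasurableSpace F]
  [SFinite (volume : Measure E)] {μ : Measure Ω} [IsProbabilityMeasure μ] {X : Ω → E} {U : Ω → F}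

theorem condDiffEntropy_eq_bot_of_comp_ae_eq (hX : AEMeasurable X μ) (hU : AEMeasurable U μ)
    {T : E → ℝ} (hT : Measurable T) (hT_null : ∀ c, volume (T ⁻¹' {c}) = 0) {m : F → ℝ}
    (hm : Measurable m) (h : ∀ᵐ ω ∂μ, T (X ω) = m (U ω)) : condDiffEntropy X U μ = ⊥ := by
  refine condDiffEntropy_eq_bot fun hac => ?_
  have hS : MeasurableSet {p : F × E | T p.2 = m p.1} :=
    measurableSet_eq_fun (by fun_prop) (by fun_prop)
  have hnull : ((μ.map U).prod volume) {p : F × E | T p.2 = m p.1} = 0 :=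
    (Measure.measure_prod_null hS).2 (.of_forall fun u => hT_null (m u))
  have hfull : ∀ᵐ p ∂μ.map (fun ω => (U ω, X ω)), T p.2 = m p.1 :=
    (ae_map_iff (hU.prodMk hX) hS).2 h
  have : IsProbabilityMeasure (μ.map fun ω => (U ω, X ω)) :=
    Measure.isProbabilityMeasure_map (hU.prodMk hX)
  simpa using (hfull.and (measure_eq_zero_iff_ae_notMem.1 (hac hnull))).exists.imp
    fun p hp => hp.2 hp.1

end Singular

section IndependentNoise

variable {Ω E F G : Type*} [MeasurableSpace Ω] [MeasureSpace E] [MeasurableSpace F]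
  [MeasurableSpace G] [SigmaFinite (volume : Measure E)] {μ : Measure Ω} [IsFiniteMeasure μ]
  {X : Ω → E} {U : Ω → F}

theorem HasCondDensity.condDiffEntropy_prodMk_of_indepFun {f : F × E → ℝ≥0∞}
    (h : HasCondDensity f X U μ) {Z : Ω → G} (hZ : AEMeasurable Z μ)
    (hind : IndepFun Z (fun ω => (X ω, U ω)) μ) :
    condDiffEntropy X (fun ω => (U ω, Z ω)) μ = condDiffEntropy X U μ := by
  rw [(h.prodMk_of_indepFun hZ hind).condDiffEntropy_eq, h.condDiffEntropy_eq]

variable [AddCommGroup E] [MeasurableAdd₂ E] [(volume : Measure E).IsAddLeftInvariant]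

theorem hasCondDensity_of_indepFun_sub [MeasurableSub₂ E] (hX : AEMeasurable X μ)
    (hU : AEMeasurable U μ) {m : F → E} (hm : Measurable m)
    (hind : IndepFun U (fun ω => X ω - m (U ω)) μ) {f : E → ℝ≥0∞} (hf : Measurable f)
    (hlaw : μ.map (fun ω => X ω - m (U ω)) = (volume : Measure E).withDensity f) :
    HasCondDensity (fun p => f (p.2 - m p.1)) X U μ := by
  refine .of_lintegral_comp hX hU (by fun_prop) fun φ hφ => ?_
  calc ∫⁻ ω, φ (U ω, X ω) ∂μ
      = ∫⁻ ω, φ (U ω, m (U ω) + (X ω - m (U ω))) ∂μ := by simp only [add_sub_cancel]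
    _ = ∫⁻ ω, ∫⁻ w, φ (U ω, m (U ω) + w) ∂(volume : Measure E).withDensity f ∂μ := by
        rw [← hlaw]
        exact lintegral_comp_prodMk_of_indepFun (φ := fun p => φ (p.1, m p.1 + p.2)) hU
          (hX.sub (hm.comp_aemeasurable hU)) hind (by fun_prop)
    _ = ∫⁻ ω, (∫⁻ x, f (x - m (U ω)) * φ (U ω, x)) ∂μ := by
        refine lintegral_congr fun ω => ?_
        rw [lintegral_withDensity_eq_lintegral_mul _ hf (by fun_prop),
          ← lintegral_add_left_eq_self (fun x => f (x - m (U ω)) * φ (U ω, x)) (m (U ω))]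
        simp only [Pi.mul_apply, add_sub_cancel_left]

theorem map_prodMk_add_le_smul {Z : Ω → E} (hX : AEMeasurable X μ) (hU : AEMeasurable U μ)
    (hZ : AEMeasurable Z μ) (hind : IndepFun Z (fun ω => (X ω, U ω)) μ) {C : ℝ≥0∞}
    (hlaw : μ.map Z ≤ C • (volume : Measure E)) :
    μ.map (fun ω => (U ω, X ω + Z ω)) ≤ C • (μ.map U).prod (volume : Measure E) := by
  refine Measure.le_iff.2 fun s hs => ?_
  have hφ : Measurable (s.indicator (1 : F × E → ℝ≥0∞)) := measurable_one.indicator hs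
  have hUY : AEMeasurable (fun ω => (U ω, X ω + Z ω)) μ := hU.prodMk (hX.add hZ)
  calc μ.map (fun ω => (U ω, X ω + Z ω)) s
      = ∫⁻ ω, s.indicator 1 (U ω, X ω + Z ω) ∂μ := by
        rw [← lintegral_indicator_one hs, lintegral_map' hφ.aemeasurable hUY]
    _ = ∫⁻ ω, ∫⁻ z, s.indicator 1 (U ω, X ω + z) ∂μ.map Z ∂μ :=
        lintegral_comp_prodMk_of_indepFun (φ := fun p => s.indicator 1 (p.1.2, p.1.1 + p.2))
          (hX.prodMk hU) hZ hind.symm (by fun_prop)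
    _ ≤ ∫⁻ ω, C * (∫⁻ z, s.indicator 1 (U ω, X ω + z)) ∂μ := lintegral_mono fun ω =>
        (lintegral_mono' hlaw le_rfl).trans_eq (lintegral_smul_measure _ _)
    _ = C * ∫⁻ ω, (∫⁻ y, s.indicator 1 (U ω, y)) ∂μ := by
        rw [lintegral_congr fun ω => congrArg (C * ·)
          (lintegral_add_left_eq_self (fun y => s.indicator 1 (U ω, y)) (X ω))]
        exact lintegral_const_mul'' C (hφ.lintegral_prod_right'.comp_aemeasurable hU)
    _ = (C • (μ.map U).prod (volume : Measure E)) s := by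
        rw [Measure.smul_apply, ← lintegral_indicator_one hs, lintegral_prod _ hφ.aemeasurable,
          lintegral_map' hφ.lintegral_prod_right'.aemeasurable hU, smul_eq_mul]

end IndependentNoise

section Variational

variable {Ω E F : Type*} [MeasurableSpace Ω] [MeasureSpace E] [MeasurableSpace F]
  [SigmaFinite (volume : Measure E)] [AddCommGroup E] [MeasurableAdd₂ E]
  [(volume : Measure E).IsAddLeftInvariant]

theorem lintegral_mul_comp_add_le {ν : Measure F} [SFinite ν] {ρ : Measure E} [SFinite ρ]
    {q : F × E → ℝ≥0∞} (hq : Measurable q) {r : (F × E) × E → ℝ≥0∞} (hr : Measurable r)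
    (hr1 : ∀ p, ∫⁻ z, r (p, z) ∂ρ ≤ 1) :
    ∫⁻ p, q (p.1.1, p.2 + p.1.2) * r ((p.1.1, p.2 + p.1.2), p.1.2) ∂(ν.prod ρ).prod volume
      ≤ ∫⁻ p, q p ∂ν.prod volume := by
  rw [lintegral_prod _ (by fun_prop), lintegral_prod _ (by fun_prop),
    lintegral_prod _ (by fun_prop)]
  refine lintegral_mono fun u => ?_
  calc ∫⁻ z, (∫⁻ x, q (u, x + z) * r ((u, x + z), z)) ∂ρ
      = ∫⁻ z, (∫⁻ y, q (u, y) * r ((u, y), z)) ∂ρ := lintegral_congr fun z =>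
        lintegral_add_right_eq_self (fun y => q (u, y) * r ((u, y), z)) z
    _ = ∫⁻ y, (∫⁻ z, q (u, y) * r ((u, y), z) ∂ρ) := lintegral_lintegral_swap (by
        simp only [Function.uncurry_def]; fun_prop)
    _ = ∫⁻ y, q (u, y) * ∫⁻ z, r ((u, y), z) ∂ρ :=
        lintegral_congr fun y => lintegral_const_mul _ (by fun_prop)
    _ ≤ ∫⁻ y, q (u, y) := lintegral_mono fun y => mul_le_of_le_one_right' (hr1 (u, y))

variable {μ : Measure Ω} [IsProbabilityMeasure μ] {X Z : Ω → E} {U : Ω → F}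

theorem condDiffEntropy_sub_add_le_neg_integral_log (hX : AEMeasurable X μ)
    (hU : AEMeasurable U μ) (hZ : AEMeasurable Z μ) (hind : IndepFun Z (fun ω => (X ω, U ω)) μ)
    (hbot : condDiffEntropy (fun ω => X ω + Z ω) U μ ≠ ⊥)
    (htop : condDiffEntropy (fun ω => X ω + Z ω) U μ ≠ ⊤)
    {r : (F × E) × E → ℝ≥0∞} (hr : Measurable r) (hr0 : ∀ p, r p ≠ 0) (hr_top : ∀ p, r p ≠ ∞)
    (hr1 : ∀ p, ∫⁻ z, r (p, z) ∂μ.map Z ≤ 1)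
    (hri : Integrable (fun ω => Real.log (r ((U ω, X ω + Z ω), Z ω)).toReal) μ) :
    condDiffEntropy X U μ - condDiffEntropy (fun ω => X ω + Z ω) U μ
      ≤ ((-∫ ω, Real.log (r ((U ω, X ω + Z ω), Z ω)).toReal ∂μ : ℝ) : EReal) := by
  by_cases hac : μ.map (fun ω => (U ω, X ω)) ≪ (μ.map U).prod (volume : Measure E)
  swap
  · rw [condDiffEntropy_eq_bot hac, EReal.bot_sub]
    exact bot_le
  set q := condDensity (fun ω => X ω + Z ω) U μ
  have hY : HasCondDensity q (fun ω => X ω + Z ω) U μ :=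
    hasCondDensity_condDensity (hX.add hZ) hU (of_not_not (mt condDiffEntropy_eq_bot hbot))
  have hq := hY.measurable
  have hqi := hY.integrable_log hbot htop
  have hlog : (fun ω => Real.log
      (q (U ω, X ω + Z ω) * r ((U ω, X ω + Z ω), Z ω)).toReal) =ᵐ[μ] fun ω =>
      Real.log (q (U ω, X ω + Z ω)).toReal + Real.log (r ((U ω, X ω + Z ω), Z ω)).toReal := by
    filter_upwards [hY.ae_ne_zero, hY.ae_ne_top] with ω h0 h_top
    rw [ENNReal.toReal_mul, Real.log_mul (ENNReal.toReal_ne_zero.2 ⟨h0, h_top⟩)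
      (ENNReal.toReal_ne_zero.2 ⟨hr0 _, hr_top _⟩)]
  have hprod : μ.map (fun ω => (U ω, Z ω)) = (μ.map U).prod (μ.map Z) :=
    (indepFun_iff_map_prod_eq_prod_map_map hU hZ).1 (hind.symm.comp measurable_snd measurable_id)
  have hgibbs := condDiffEntropy_le_neg_integral_log hX (hU.prodMk hZ)
    (g := fun p => q (p.1.1, p.2 + p.1.2) * r ((p.1.1, p.2 + p.1.2), p.1.2)) (by fun_prop)
    (hY.ae_ne_zero.mono fun ω h0 => mul_ne_zero h0 (hr0 _))
    (by
      rw [hprod]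
      refine (lintegral_mul_comp_add_le hq hr hr1).trans_eq ?_
      rw [hY.lintegral_eq, measure_univ])
    ((hqi.add hri).congr hlog.symm)
  rw [(hasCondDensity_condDensity hX hU hac).condDiffEntropy_prodMk_of_indepFun hZ hind,
    integral_congr_ae hlog, integral_add hqi hri, neg_add_rev, EReal.coe_add,
    ← hY.condDiffEntropy_eq_neg_integral hqi] at hgibbs
  exact EReal.sub_le_of_le_add hgibbs

end Variational

section FiniteProducts

variable {ι : Type*} [Fintype ι] {E : ι → Type*} [∀ i, MeasurableSpace (E i)]
  {ν : ∀ i, Measure (E i)} [∀ i, SigmaFinite (ν i)] {f : ∀ i, E i → ℝ≥0∞}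

theorem lmarginal_prod_eval [DecidableEq ι] (hf : ∀ i, Measurable (f i)) (s : Finset ι)
    (x : ∀ i, E i) :
    lmarginal ν s (fun x => ∏ i, f i (x i)) x
      = (∏ i ∈ s, ∫⁻ a, f i a ∂ν i) * ∏ i ∈ sᶜ, f i (x i) := by
  induction s using Finset.induction_on generalizing x with
  | empty => simp
  | insert i s hi ih =>
    have hupdate : ∀ a, ∏ j ∈ sᶜ, f j (Function.update x i a j)
        = f i a * ∏ j ∈ (insert i s)ᶜ, f j (x j) := fun a => by
      rw [← Finset.mul_prod_erase _ _ (Finset.mem_compl.2 hi), Finset.compl_insert,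
        Function.update_self]
      congr 1
      exact Finset.prod_congr rfl fun j hj => by
        rw [Function.update_of_ne (Finset.ne_of_mem_erase hj)]
    rw [lmarginal_insert _ (by fun_prop) hi]
    simp_rw [ih, hupdate]
    rw [lintegral_const_mul _ (by fun_prop), lintegral_mul_const _ (hf i), Finset.prod_insert hi]
    ring

theorem lintegral_fintype_prod_eq_prod (hf : ∀ i, Measurable (f i)) :
    ∫⁻ x, ∏ i, f i (x i) ∂Measure.pi ν = ∏ i, ∫⁻ a, f i a ∂ν i := by
  classical
  obtain hE | ⟨⟨x⟩⟩ := isEmpty_or_nonempty (∀ i, E i)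
  · obtain ⟨i, _⟩ := isEmpty_pi.1 hE
    rw [lintegral_of_isEmpty, Finset.prod_eq_zero (Finset.mem_univ i) (lintegral_of_isEmpty _ _)]
  · rw [lintegral_eq_lmarginal_univ x, lmarginal_prod_eval hf]
    simp

theorem pi_withDensity (hf : ∀ i, Measurable (f i))
    [∀ i, SigmaFinite ((ν i).withDensity (f i))] :
    Measure.pi (fun i => (ν i).withDensity (f i))
      = (Measure.pi ν).withDensity fun x => ∏ i, f i (x i) := by
  refine Measure.pi_eq fun s hs => ?_
  rw [withDensity_apply _ (.univ_pi hs), Measure.restrict_pi_pi, lintegral_fintype_prod_eq_prod hf]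
  exact Finset.prod_congr rfl fun i _ => (withDensity_apply _ (hs i)).symm

end FiniteProducts

section GaussianPDF

theorem gaussianPDF_sub_mul_gaussianPDF {v s : ℝ≥0} (hv : v ≠ 0) (hs : s ≠ 0) (y z : ℝ) :
    gaussianPDF 0 v (y - z) * gaussianPDF 0 s z
      = gaussianPDF 0 (v + s) y * gaussianPDF (s / (v + s) * y) (v * s / (v + s)) z := by
  simp only [gaussianPDF]
  rw [← ENNReal.ofReal_mul (gaussianPDFReal_nonneg _ _ _),
    ← ENNReal.ofReal_mul (gaussianPDFReal_nonneg _ _ _)]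
  congr 1
  simp only [gaussianPDFReal]
  rw [mul_mul_mul_comm, mul_mul_mul_comm (√(2 * Real.pi * (v + s : ℝ≥0)))⁻¹, ← mul_inv, ← mul_inv,
    ← Real.sqrt_mul (by positivity), ← Real.sqrt_mul (by positivity), ← Real.exp_add,
    ← Real.exp_add]
  congr 1
  · congr 2
    push_cast
    field_simp
  · congr 1
    push_cast
    field_simp
    ring

theorem lintegral_gaussianPDF_sub {v : ℝ≥0} (hv : v ≠ 0) (s : ℝ≥0) (y : ℝ) :
    ∫⁻ z, gaussianPDF 0 v (y - z) ∂gaussianReal 0 s = gaussianPDF 0 (v + s) y := by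
  have hmeas : Measurable fun z => gaussianPDF 0 v (y - z) := by fun_prop
  obtain rfl | hs := eq_or_ne s 0
  · rw [gaussianReal_zero_var, lintegral_dirac' _ hmeas, sub_zero, add_zero]
  rw [gaussianReal_of_var_ne_zero 0 hs,
    lintegral_withDensity_eq_lintegral_mul _ (measurable_gaussianPDF 0 s) hmeas]
  simp only [Pi.mul_apply]
  rw [lintegral_congr fun z => (mul_comm _ _).trans (gaussianPDF_sub_mul_gaussianPDF hv hs y z),
    lintegral_const_mul _ (measurable_gaussianPDF _ _),
    lintegral_gaussianPDF_eq_one _ (by positivity), mul_one]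

theorem gaussianPDF_le (m : ℝ) (v : ℝ≥0) (x : ℝ) :
    gaussianPDF m v x ≤ ENNReal.ofReal (√(2 * Real.pi * v))⁻¹ :=
  ENNReal.ofReal_le_ofReal <| mul_le_of_le_one_right (by positivity) <| Real.exp_le_one_iff.2 <|
    div_nonpos_of_nonpos_of_nonneg (neg_nonpos.2 (sq_nonneg _)) (by positivity)

theorem log_toReal_gaussianPDF (m : ℝ) {v : ℝ≥0} (hv : v ≠ 0) (x : ℝ) :
    Real.log (gaussianPDF m v x).toReal
      = -(Real.log (2 * Real.pi * v) / 2) - (x - m) ^ 2 / (2 * v) := by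
  rw [toReal_gaussianPDF, gaussianPDFReal, Real.log_mul (by positivity) (by positivity),
    Real.log_inv, Real.log_sqrt (by positivity), Real.log_exp]
  ring

variable {ι : Type*} [Fintype ι]

/-- The density of the law of a family of independent centred real Gaussian variables with common
variance `v ≠ 0`; identically zero for `v = 0` when the family is nonempty. -/
noncomputable def gaussianPiPDF (v : ℝ≥0) (x : ι → ℝ) : ℝ≥0∞ :=
  ∏ j, gaussianPDF 0 v (x j)

@[fun_prop]
theorem measurable_gaussianPiPDF (v : ℝ≥0) : Measurable (gaussianPiPDF v : (ι → ℝ) → ℝ≥0∞) := by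
  unfold gaussianPiPDF
  fun_prop

theorem gaussianPiPDF_ne_zero {v : ℝ≥0} (hv : v ≠ 0) (x : ι → ℝ) : gaussianPiPDF v x ≠ 0 :=
  Finset.prod_ne_zero_iff.2 fun _ _ => (gaussianPDF_pos _ hv _).ne'

theorem gaussianPiPDF_ne_top (v : ℝ≥0) (x : ι → ℝ) : gaussianPiPDF v x ≠ ∞ :=
  ENNReal.prod_ne_top fun _ _ => gaussianPDF_ne_top

theorem gaussianPiPDF_le (v : ℝ≥0) (x : ι → ℝ) :
    gaussianPiPDF v x ≤ ENNReal.ofReal (√(2 * Real.pi * v))⁻¹ ^ Fintype.card ι :=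
  Finset.prod_le_pow_card _ _ _ fun _ _ => gaussianPDF_le 0 v _

theorem pi_gaussianReal_eq_withDensity {v : ℝ≥0} (hv : v ≠ 0) :
    Measure.pi (fun _ : ι => gaussianReal 0 v) = volume.withDensity (gaussianPiPDF v) := by
  have : SigmaFinite ((volume : Measure ℝ).withDensity (gaussianPDF 0 v)) :=
    gaussianReal_of_var_ne_zero 0 hv ▸ inferInstance
  rw [gaussianReal_of_var_ne_zero 0 hv]
  exact pi_withDensity fun _ => measurable_gaussianPDF 0 v

theorem pi_gaussianReal_le_smul_volume {v : ℝ≥0} (hv : v ≠ 0) :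
    Measure.pi (fun _ : ι => gaussianReal 0 v)
      ≤ ENNReal.ofReal (√(2 * Real.pi * v))⁻¹ ^ Fintype.card ι • (volume : Measure (ι → ℝ)) := by
  rw [pi_gaussianReal_eq_withDensity hv, ← withDensity_const]
  exact withDensity_mono (.of_forall fun x => gaussianPiPDF_le v x)

theorem lintegral_gaussianPiPDF {v : ℝ≥0} (hv : v ≠ 0) :
    ∫⁻ x : ι → ℝ, gaussianPiPDF v x = 1 := by
  rw [← setLIntegral_univ, ← withDensity_apply _ .univ, ← pi_gaussianReal_eq_withDensity hv,
    measure_univ]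

theorem lintegral_gaussianPiPDF_sub {v : ℝ≥0} (hv : v ≠ 0) (s : ℝ≥0) (y : ι → ℝ) :
    ∫⁻ z, gaussianPiPDF v (y - z) ∂Measure.pi (fun _ => gaussianReal 0 s)
      = gaussianPiPDF (v + s) y := by
  refine (lintegral_fintype_prod_eq_prod (f := fun j z => gaussianPDF 0 v (y j - z))
    fun j => by fun_prop).trans ?_
  exact Finset.prod_congr rfl fun j _ => lintegral_gaussianPDF_sub hv s (y j)

theorem log_toReal_gaussianPiPDF {v : ℝ≥0} (hv : v ≠ 0) (x : ι → ℝ) :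
    Real.log (gaussianPiPDF v x).toReal
      = -(Fintype.card ι * (Real.log (2 * Real.pi * v) / 2)) - (∑ j, x j ^ 2) / (2 * v) := by
  rw [gaussianPiPDF, ENNReal.toReal_prod, Real.log_prod fun j _ =>
    (ENNReal.toReal_pos (gaussianPDF_pos _ hv _).ne' gaussianPDF_ne_top).ne']
  simp only [log_toReal_gaussianPDF 0 hv, sub_zero, Finset.sum_sub_distrib, Finset.sum_const,
    Finset.card_univ, nsmul_eq_mul, mul_neg, Finset.sum_div]

variable {Ω : Type*} [MeasurableSpace Ω] {μ : Measure Ω} {D : Ω → ι → ℝ}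

theorem integrable_log_gaussianPiPDF [IsFiniteMeasure μ] {v : ℝ≥0} (hv : v ≠ 0)
    (hD : ∀ j, MemLp (fun ω => D ω j) 2 μ) :
    Integrable (fun ω => Real.log (gaussianPiPDF v (D ω)).toReal) μ := by
  simp_rw [log_toReal_gaussianPiPDF hv]
  exact (integrable_const _).sub
    ((integrable_finsetSum _ fun j _ => (hD j).integrable_sq).div_const _)

theorem integral_log_gaussianPiPDF [IsProbabilityMeasure μ] {v : ℝ≥0} (hv : v ≠ 0)
    (hD : ∀ j, MemLp (fun ω => D ω j) 2 μ) :
    ∫ ω, Real.log (gaussianPiPDF v (D ω)).toReal ∂μ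
      = -(Fintype.card ι * (Real.log (2 * Real.pi * v) / 2))
        - (∑ j, ∫ ω, D ω j ^ 2 ∂μ) / (2 * v) := by
  simp_rw [log_toReal_gaussianPiPDF hv]
  rw [integral_sub (integrable_const _)
    ((integrable_finsetSum _ fun j _ => (hD j).integrable_sq).div_const _), integral_div,
    integral_finsetSum _ fun j _ => (hD j).integrable_sq, integral_const, probReal_univ, one_smul]

end GaussianPDF

section GaussianEntropy

/-- The differential entropy of the normal distribution with variance `v`, which is `-∞` for the
point mass `v = 0`. -/
noncomputable def gaussianEntropy (v : ℝ≥0) : EReal :=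
  if v = 0 then ⊥ else (((Real.log (2 * Real.pi * v) + 1) / 2 : ℝ) : EReal)

@[simp]
theorem gaussianEntropy_zero : gaussianEntropy 0 = ⊥ := if_pos rfl

theorem gaussianEntropy_of_ne_zero {v : ℝ≥0} (hv : v ≠ 0) :
    gaussianEntropy v = (((Real.log (2 * Real.pi * v) + 1) / 2 : ℝ) : EReal) := if_neg hv

theorem gaussianEntropy_lt_top (v : ℝ≥0) : gaussianEntropy v < ⊤ := by
  obtain rfl | hv := eq_or_ne v 0
  · exact gaussianEntropy_zero ▸ bot_lt_top
  · exact gaussianEntropy_of_ne_zero hv ▸ EReal.coe_lt_top _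

theorem bot_lt_gaussianEntropy {v : ℝ≥0} (hv : v ≠ 0) : ⊥ < gaussianEntropy v :=
  gaussianEntropy_of_ne_zero hv ▸ EReal.bot_lt_coe _

end GaussianEntropy

theorem hasLaw_eval_of_hasLaw_pi {Ω ι : Type*} [MeasurableSpace Ω] [Fintype ι] {E : ι → Type*}
    [∀ i, MeasurableSpace (E i)] {μ : Measure Ω} {ν : ∀ i, Measure (E i)}
    [∀ i, IsProbabilityMeasure (ν i)] {Z : Ω → ∀ i, E i} (hZ : HasLaw Z (Measure.pi ν) μ) (i : ι) :
    HasLaw (fun ω => Z ω i) (ν i) μ :=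
  (measurePreserving_eval ν i).fun_comp_hasLaw hZ

section Moments

variable {Ω : Type*} [MeasurableSpace Ω] {μ : Measure Ω} {D Z : Ω → ℝ} {s : ℝ≥0}

theorem memLp_two_of_hasLaw_gaussianReal (hZ : HasLaw Z (gaussianReal 0 s) μ) : MemLp Z 2 μ := by
  have h := memLp_id_gaussianReal (μ := 0) (v := s) 2
  rw [← hZ.map_eq] at h
  exact h.comp_of_map hZ.aemeasurable

theorem integral_sq_of_hasLaw_gaussianReal (hZ : HasLaw Z (gaussianReal 0 s) μ) :
    ∫ ω, Z ω ^ 2 ∂μ = s := by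
  have hmean : ∫ ω, Z ω ∂μ = 0 := hZ.integral_eq.trans integral_id_gaussianReal
  rw [← variance_of_integral_eq_zero hZ.aemeasurable hmean, hZ.variance_eq,
    variance_id_gaussianReal]

theorem integral_sq_add_gaussian (hD : MemLp D 2 μ) (hZ : HasLaw Z (gaussianReal 0 s) μ)
    (hind : IndepFun D Z μ) : ∫ ω, (D ω + Z ω) ^ 2 ∂μ = ∫ ω, D ω ^ 2 ∂μ + s := by
  have hZ2 := memLp_two_of_hasLaw_gaussianReal hZ
  have hcross : ∫ ω, D ω * Z ω ∂μ = 0 := by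
    rw [hind.integral_fun_mul_eq_mul_integral hD.aestronglyMeasurable hZ2.aestronglyMeasurable,
      hZ.integral_eq, integral_id_gaussianReal, mul_zero]
  have hDZ : Integrable (fun ω => D ω * Z ω) μ := hD.integrable_mul hZ2
  calc ∫ ω, (D ω + Z ω) ^ 2 ∂μ = ∫ ω, (D ω ^ 2 + 2 * (D ω * Z ω) + Z ω ^ 2) ∂μ := by
        congr with ω
        ring
    _ = ∫ ω, D ω ^ 2 ∂μ + s := by
        rw [integral_add (f := fun ω => D ω ^ 2 + 2 * (D ω * Z ω))
            (hD.integrable_sq.add (hDZ.const_mul 2)) hZ2.integrable_sq,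
          integral_add hD.integrable_sq (hDZ.const_mul 2), integral_const_mul, hcross,
          integral_sq_of_hasLaw_gaussianReal hZ, mul_zero, add_zero]

end Moments

section LikelihoodRatio

variable {ι F : Type*} [Fintype ι] {m : F → ι → ℝ} {v s : ℝ≥0}

/-- In the Gaussian model `Y = m(U) + W + Z` with independent `U`, `W ∼ N(0, v I)`, `Z ∼ N(0, s I)`,
the likelihood ratio at `((u, y), z)` of the conditional law of `Z` given `(U, Y) = (u, y)` with
respect to the law of `Z`. -/
noncomputable def gaussianLikelihoodRatio (m : F → ι → ℝ) (v s : ℝ≥0)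
    (p : (F × (ι → ℝ)) × (ι → ℝ)) : ℝ≥0∞ :=
  gaussianPiPDF v (p.1.2 - p.2 - m p.1.1) / gaussianPiPDF (v + s) (p.1.2 - m p.1.1)

@[fun_prop]
theorem measurable_gaussianLikelihoodRatio [MeasurableSpace F] (hm : Measurable m) :
    Measurable (gaussianLikelihoodRatio m v s) := by
  unfold gaussianLikelihoodRatio
  fun_prop

theorem gaussianLikelihoodRatio_ne_zero (hv : v ≠ 0) (p : (F × (ι → ℝ)) × (ι → ℝ)) :
    gaussianLikelihoodRatio m v s p ≠ 0 :=
  ENNReal.div_ne_zero.2 ⟨gaussianPiPDF_ne_zero hv _, gaussianPiPDF_ne_top _ _⟩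

theorem gaussianLikelihoodRatio_ne_top (hv : v ≠ 0) (p : (F × (ι → ℝ)) × (ι → ℝ)) :
    gaussianLikelihoodRatio m v s p ≠ ∞ :=
  ENNReal.div_ne_top (gaussianPiPDF_ne_top _ _) (gaussianPiPDF_ne_zero (by positivity) _)

theorem lintegral_gaussianLikelihoodRatio (hv : v ≠ 0) (p : F × (ι → ℝ)) :
    ∫⁻ z, gaussianLikelihoodRatio m v s (p, z) ∂Measure.pi (fun _ => gaussianReal 0 s) = 1 := by
  simp only [gaussianLikelihoodRatio, div_eq_mul_inv, sub_right_comm p.2 _ (m p.1)]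
  rw [lintegral_mul_const _ (by fun_prop), lintegral_gaussianPiPDF_sub hv,
    ENNReal.mul_inv_cancel (gaussianPiPDF_ne_zero (by positivity) _) (gaussianPiPDF_ne_top _ _)]

theorem log_toReal_gaussianLikelihoodRatio (hv : v ≠ 0) (u : F) (x z : ι → ℝ) :
    Real.log (gaussianLikelihoodRatio m v s ((u, x + z), z)).toReal
      = Real.log (gaussianPiPDF v (x - m u)).toReal
        - Real.log (gaussianPiPDF (v + s) (x - m u + z)).toReal := by
  have hne {w : ℝ≥0} (hw : w ≠ 0) (x : ι → ℝ) : (gaussianPiPDF w x).toReal ≠ 0 :=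
    ENNReal.toReal_ne_zero.2 ⟨gaussianPiPDF_ne_zero hw x, gaussianPiPDF_ne_top w x⟩
  rw [gaussianLikelihoodRatio, ENNReal.toReal_div, add_sub_cancel_right, add_sub_right_comm,
    Real.log_div (hne hv _) (hne (by positivity) _)]

variable {Ω : Type*} [MeasurableSpace Ω] {μ : Measure Ω} [IsProbabilityMeasure μ]
  {X Z : Ω → ι → ℝ} {U : Ω → F}

theorem integrable_log_gaussianLikelihoodRatio (hv : v ≠ 0)
    (hZ : HasLaw Z (Measure.pi fun _ => gaussianReal 0 s) μ)
    (hD : ∀ j, MemLp (fun ω => X ω j - m (U ω) j) 2 μ) :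
    Integrable (fun ω =>
      Real.log (gaussianLikelihoodRatio m v s ((U ω, X ω + Z ω), Z ω)).toReal) μ := by
  simp only [log_toReal_gaussianLikelihoodRatio hv]
  exact (integrable_log_gaussianPiPDF hv hD).sub (integrable_log_gaussianPiPDF (by positivity)
    fun j => (hD j).add (memLp_two_of_hasLaw_gaussianReal (hasLaw_eval_of_hasLaw_pi hZ j)))

theorem integral_log_gaussianLikelihoodRatio (hv : v ≠ 0)
    (hZ : HasLaw Z (Measure.pi fun _ => gaussianReal 0 s) μ)
    (hD : ∀ j, MemLp (fun ω => X ω j - m (U ω) j) 2 μ)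
    (hind : ∀ j, IndepFun (fun ω => X ω j - m (U ω) j) (fun ω => Z ω j) μ) :
    ∫ ω, Real.log (gaussianLikelihoodRatio m v s ((U ω, X ω + Z ω), Z ω)).toReal ∂μ
      = Fintype.card ι * (Real.log (2 * Real.pi * (v + s)) / 2 - Real.log (2 * Real.pi * v) / 2)
        + ((∑ j, ∫ ω, (X ω j - m (U ω) j) ^ 2 ∂μ) + Fintype.card ι * s) / (2 * (v + s))
        - (∑ j, ∫ ω, (X ω j - m (U ω) j) ^ 2 ∂μ) / (2 * v) := by
  have hZj := hasLaw_eval_of_hasLaw_pi hZ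
  have hDZ (j : ι) : MemLp (fun ω => X ω j - m (U ω) j + Z ω j) 2 μ :=
    (hD j).add (memLp_two_of_hasLaw_gaussianReal (hZj j))
  have hvs : v + s ≠ 0 := by positivity
  have hintD : Integrable (fun ω => Real.log (gaussianPiPDF v (X ω - m (U ω))).toReal) μ :=
    integrable_log_gaussianPiPDF hv hD
  have hintDZ : Integrable
      (fun ω => Real.log (gaussianPiPDF (v + s) (X ω - m (U ω) + Z ω)).toReal) μ :=
    integrable_log_gaussianPiPDF hvs hDZ
  simp only [log_toReal_gaussianLikelihoodRatio hv]
  rw [integral_sub hintD hintDZ,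
    integral_log_gaussianPiPDF (D := fun ω => X ω - m (U ω)) hv hD,
    integral_log_gaussianPiPDF (D := fun ω => X ω - m (U ω) + Z ω) hvs hDZ]
  simp only [Pi.add_apply, Pi.sub_apply, integral_sq_add_gaussian (hD _) (hZj _) (hind _),
    Finset.sum_add_distrib, Finset.sum_const, Finset.card_univ, nsmul_eq_mul, NNReal.coe_add]
  ring

end LikelihoodRatio

theorem half_div_sub_half_div_le {A n v s : ℝ} (hv : 0 < v) (hs : 0 ≤ s) (hA : A ≤ n * v) :
    A / (2 * v) - (A + n * s) / (2 * (v + s)) ≤ 0 := by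
  rw [sub_nonpos, div_le_div_iff₀ (by positivity) (by positivity)]
  nlinarith [mul_le_mul_of_nonneg_right hA hs]

section GaussianNoise

variable {Ω ι F : Type*} [MeasurableSpace Ω] [Fintype ι] [MeasurableSpace F]
  {μ : Measure Ω} {X Z : Ω → ι → ℝ} {U : Ω → F} {m : F → ι → ℝ} {v s : ℝ≥0}

theorem condDiffEntropy_sub_add_zero_le
    (hZ : HasLaw Z (Measure.pi fun _ => gaussianReal 0 0) μ) :
    condDiffEntropy X U μ - condDiffEntropy (fun ω => X ω + Z ω) U μ ≤ 0 := by
  have hZ0 : Z =ᵐ[μ] 0 := by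
    rw [gaussianReal_zero_var] at hZ
    filter_upwards [ae_all_iff.2 fun j => (hasLaw_eval_of_hasLaw_pi hZ j).ae_eq_of_dirac] with ω hω
    exact funext hω
  have hXZ : (fun ω => X ω + Z ω) =ᵐ[μ] X := by
    filter_upwards [hZ0] with ω hω
    rw [hω, Pi.zero_apply, add_zero]
  rw [condDiffEntropy_congr hXZ (ae_eq_refl U)]
  exact EReal.sub_self_le_zero

variable [IsProbabilityMeasure μ]

theorem condDiffEntropy_lt_top_of_memLp_sub (hX : AEMeasurable X μ) (hU : AEMeasurable U μ)
    (hm : Measurable m) (hD : ∀ j, MemLp (fun ω => X ω j - m (U ω) j) 2 μ) :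
    condDiffEntropy X U μ < ⊤ := by
  have hone : ∫⁻ p : F × (ι → ℝ), gaussianPiPDF 1 (p.2 - m p.1) ∂(μ.map U).prod volume = 1 := by
    have := Measure.isProbabilityMeasure_map hU
    rw [lintegral_prod _ (by fun_prop)]
    simp only [lintegral_sub_right_eq_self (gaussianPiPDF 1 : (ι → ℝ) → ℝ≥0∞),
      lintegral_gaussianPiPDF one_ne_zero, lintegral_const, measure_univ, mul_one]
  exact (condDiffEntropy_le_neg_integral_log hX hU (by fun_prop)
    (.of_forall fun ω => gaussianPiPDF_ne_zero one_ne_zero _) hone.le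
    (integrable_log_gaussianPiPDF one_ne_zero hD)).trans_lt (EReal.coe_lt_top _)

theorem condDiffEntropy_lt_top_of_memLp (hX : ∀ j, MemLp (fun ω => X ω j) 2 μ)
    (hU : AEMeasurable U μ) : condDiffEntropy X U μ < ⊤ :=
  condDiffEntropy_lt_top_of_memLp_sub (aemeasurable_pi_lambda _ fun j => (hX j).aemeasurable) hU
    (m := 0) measurable_const (by simpa using hX)

theorem bot_lt_condDiffEntropy_add_gaussian (hX : AEMeasurable X μ) (hU : AEMeasurable U μ)
    (hs : s ≠ 0) (hZ : HasLaw Z (Measure.pi fun _ => gaussianReal 0 s) μ)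
    (hind : IndepFun Z (fun ω => (X ω, U ω)) μ) :
    ⊥ < condDiffEntropy (fun ω => X ω + Z ω) U μ :=
  bot_lt_condDiffEntropy_of_map_le_smul (hX.add hZ.aemeasurable) hU
    (ENNReal.pow_ne_top ENNReal.ofReal_ne_top)
    (map_prodMk_add_le_smul hX hU hZ.aemeasurable hind
      (hZ.map_eq.trans_le (pi_gaussianReal_le_smul_volume hs)))

theorem condDiffEntropy_eq_bot_of_sum_integral_sq_sub_nonpos [Nonempty ι] (hX : AEMeasurable X μ)
    (hU : AEMeasurable U μ) (hm : Measurable m) (hD : ∀ j, MemLp (fun ω => X ω j - m (U ω) j) 2 μ)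
    (hle : ∑ j, ∫ ω, (X ω j - m (U ω) j) ^ 2 ∂μ ≤ 0) : condDiffEntropy X U μ = ⊥ := by
  have hnonneg (j : ι) : 0 ≤ ∫ ω, (X ω j - m (U ω) j) ^ 2 ∂μ :=
    integral_nonneg fun ω => sq_nonneg _
  obtain ⟨j⟩ := ‹Nonempty ι›
  have hj : ∫ ω, (X ω j - m (U ω) j) ^ 2 ∂μ = 0 :=
    (Finset.sum_eq_zero_iff_of_nonneg fun j _ => hnonneg j).1
      (hle.antisymm (Finset.sum_nonneg fun j _ => hnonneg j)) j (Finset.mem_univ j)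
  refine condDiffEntropy_eq_bot_of_comp_ae_eq hX hU (measurable_pi_apply j)
    (fun c => Measure.pi_hyperplane (fun _ : ι => (volume : Measure ℝ)) j c)
    ((measurable_pi_apply j).comp hm) ?_
  filter_upwards [(integral_eq_zero_iff_of_nonneg (fun ω => sq_nonneg _)
    (hD j).integrable_sq).1 hj] with ω hω
  exact sub_eq_zero.1 (pow_eq_zero_iff two_ne_zero |>.1 hω)

theorem condDiffEntropy_sub_add_gaussian_le [Nonempty ι] (hX : AEMeasurable X μ)
    (hU : AEMeasurable U μ) (hZ : HasLaw Z (Measure.pi fun _ => gaussianReal 0 s) μ)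
    (hind : IndepFun Z (fun ω => (X ω, U ω)) μ) (hm : Measurable m)
    (hD : ∀ j, MemLp (fun ω => X ω j - m (U ω) j) 2 μ)
    (hle : ∑ j, ∫ ω, (X ω j - m (U ω) j) ^ 2 ∂μ ≤ Fintype.card ι * v) :
    condDiffEntropy X U μ - condDiffEntropy (fun ω => X ω + Z ω) U μ
      ≤ Fintype.card ι * gaussianEntropy v - Fintype.card ι * gaussianEntropy (v + s) := by
  obtain rfl | hv := eq_or_ne v 0
  · rw [condDiffEntropy_eq_bot_of_sum_integral_sq_sub_nonpos hX hU hm hD (by simpa using hle),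
      EReal.bot_sub]
    exact bot_le
  have hcoe (w : ℝ≥0) (hw : w ≠ 0) : (Fintype.card ι : EReal) * gaussianEntropy w
      = ((Fintype.card ι * ((Real.log (2 * Real.pi * w) + 1) / 2) : ℝ) : EReal) := by
    rw [gaussianEntropy_of_ne_zero hw]
    norm_cast
  rw [hcoe v hv, hcoe (v + s) (by positivity), ← EReal.coe_sub]
  obtain rfl | hs := eq_or_ne s 0
  · simpa using condDiffEntropy_sub_add_zero_le hZ
  have hindj (j : ι) : IndepFun (fun ω => X ω j - m (U ω) j) (fun ω => Z ω j) μ :=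
    hind.symm.comp (φ := fun p : (ι → ℝ) × F => p.1 j - m p.2 j) (by fun_prop)
      (measurable_pi_apply j)
  have hDZ (j : ι) : MemLp (fun ω => (X ω + Z ω) j - m (U ω) j) 2 μ := by
    simp only [Pi.add_apply, add_sub_right_comm]
    exact (hD j).add (memLp_two_of_hasLaw_gaussianReal (hasLaw_eval_of_hasLaw_pi hZ j))
  refine (condDiffEntropy_sub_add_le_neg_integral_log hX hU hZ.aemeasurable hind
    (bot_lt_condDiffEntropy_add_gaussian hX hU hs hZ hind).ne'
    (condDiffEntropy_lt_top_of_memLp_sub (hX.add hZ.aemeasurable) hU hm hDZ).ne (by fun_prop)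
    (gaussianLikelihoodRatio_ne_zero hv) (gaussianLikelihoodRatio_ne_top hv)
    (fun p => hZ.map_eq ▸ (lintegral_gaussianLikelihoodRatio hv p).le)
    (integrable_log_gaussianLikelihoodRatio hv hZ hD)).trans ?_
  rw [integral_log_gaussianLikelihoodRatio hv hZ hD hindj, EReal.coe_le_coe_iff]
  have := half_div_sub_half_div_le (by positivity) s.coe_nonneg hle
  push_cast
  linarith

end GaussianNoise

theorem pi_conv_pi {ι : Type*} [Fintype ι] {E : Type*} [MeasurableSpace E] [AddMonoid E]
    [MeasurableAdd₂ E] (ν ρ : ι → Measure E) [∀ j, IsFiniteMeasure (ν j)]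
    [∀ j, IsFiniteMeasure (ρ j)] :
    Measure.pi ν ∗ Measure.pi ρ = Measure.pi fun j => ν j ∗ ρ j := by
  have hprod := (measurePreserving_arrowProdEquivProdArrow E E ι ν ρ).map_eq
  rw [Measure.conv, ← hprod, Measure.map_map (by fun_prop) (by fun_prop)]
  exact Measure.pi_map_pi (f := fun _ (p : E × E) => p.1 + p.2) fun j => by fun_prop

/-- Conditionally on `U = u`, the random variable `X` has law `ν` translated by `m u`. This is
encoded as: the residual `X - m(U)` has law `ν` and is independent of `U`. -/
structure HasResidualLaw {Ω E F : Type*} [MeasurableSpace Ω] [MeasurableSpace E] [Sub E]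
    [MeasurableSpace F] (X : Ω → E) (U : Ω → F) (m : F → E) (ν : Measure E) (μ : Measure Ω) :
    Prop where
  measurable : Measurable m
  hasLaw_prodMk : HasLaw (fun ω => (U ω, X ω - m (U ω))) ((μ.map U).prod ν) μ

namespace HasResidualLaw

section Basic

variable {Ω E F : Type*} [MeasurableSpace Ω] [MeasurableSpace E] [MeasurableSpace F]
  {μ : Measure Ω} {X : Ω → E} {U : Ω → F} {m : F → E} {ν : Measure E}

theorem of_identDistrib [Sub E] [MeasurableSub₂ E] {Ω' : Type*} [MeasurableSpace Ω']
    {μ' : Measure Ω'} {X' : Ω' → E} {U' : Ω' → F} (h : HasResidualLaw X U m ν μ)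
    (hd : IdentDistrib (fun ω => (X ω, U ω)) (fun ω => (X' ω, U' ω)) μ μ') :
    HasResidualLaw X' U' m ν μ' where
  measurable := h.measurable
  hasLaw_prodMk := by
    have hm := h.measurable
    have hU : μ.map U = μ'.map U' := (hd.comp measurable_snd).map_eq
    exact (hd.comp (u := fun p : E × F => (p.2, p.1 - m p.2)) (by fun_prop)).hasLaw
      (hU ▸ h.hasLaw_prodMk)

theorem aemeasurable_cond [Sub E] (h : HasResidualLaw X U m ν μ) : AEMeasurable U μ :=
  h.hasLaw_prodMk.aemeasurable.fst

theorem aemeasurable [AddGroup E] [MeasurableAdd₂ E] (h : HasResidualLaw X U m ν μ) :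
    AEMeasurable X μ := by
  have hmU := h.measurable.comp_aemeasurable h.aemeasurable_cond
  simpa [Pi.add_def] using h.hasLaw_prodMk.aemeasurable.snd.add hmU

variable [IsProbabilityMeasure μ]

theorem of_indepFun [Sub E] (hU : AEMeasurable U μ) (hm : Measurable m)
    (hind : IndepFun U (fun ω => X ω - m (U ω)) μ) (hlaw : HasLaw (fun ω => X ω - m (U ω)) ν μ) :
    HasResidualLaw X U m ν μ :=
  ⟨hm, hind.hasLaw_prod ⟨hU, rfl⟩ hlaw⟩

theorem hasLaw [Sub E] [SFinite ν] (h : HasResidualLaw X U m ν μ) :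
    HasLaw (fun ω => X ω - m (U ω)) ν μ := by
  have := Measure.isProbabilityMeasure_map h.aemeasurable_cond
  exact measurePreserving_snd.fun_comp_hasLaw h.hasLaw_prodMk

theorem indepFun [Sub E] [SFinite ν] (h : HasResidualLaw X U m ν μ) :
    IndepFun U (fun ω => X ω - m (U ω)) μ :=
  (indepFun_iff_hasLaw_prodMk_prod ⟨h.aemeasurable_cond, rfl⟩ h.hasLaw).2 h.hasLaw_prodMk

theorem add_indep [AddCommGroup E] [MeasurableAdd₂ E] [MeasurableSub₂ E] [SFinite ν]
    (h : HasResidualLaw X U m ν μ) {Z : Ω → E} {ρ : Measure E} [SFinite ρ] (hZ : HasLaw Z ρ μ)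
    (hind : IndepFun Z (fun ω => (X ω, U ω)) μ) :
    HasResidualLaw (fun ω => X ω + Z ω) U m (ν ∗ ρ) μ where
  measurable := h.measurable
  hasLaw_prodMk := by
    have hm := h.measurable
    have hUDZ : IndepFun (fun ω => (U ω, X ω - m (U ω))) Z μ :=
      hind.symm.comp (φ := fun p : E × F => (p.2, p.1 - m p.2)) (by fun_prop) measurable_id
    have hadd : MeasurePreserving (fun p : E × E => p.1 + p.2) (ν.prod ρ) (ν ∗ ρ) :=
      ⟨measurable_add, rfl⟩
    have hlaw := ((MeasurePreserving.id (μ.map U)).prod hadd).fun_comp_hasLaw <|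
      (measurePreserving_prodAssoc _ ν ρ).fun_comp_hasLaw (hUDZ.hasLaw_prod h.hasLaw_prodMk hZ)
    simpa [MeasurableEquiv.prodAssoc, Prod.map, sub_add_eq_add_sub] using hlaw

end Basic

theorem pi {Ω ι : Type*} [MeasurableSpace Ω] [Fintype ι] {E F : Type*} [MeasurableSpace E]
    [MeasurableSpace F] [Sub E] [MeasurableSub₂ E] {μ : Measure Ω} [IsProbabilityMeasure μ]
    {X : Ω → ι → E} {U : Ω → ι → F} {m : ι → F → E} {ν : ι → Measure E} [∀ j, SigmaFinite (ν j)]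
    (h : ∀ j, HasResidualLaw (fun ω => X ω j) (fun ω => U ω j) (m j) (ν j) μ)
    (hind : iIndepFun (fun j ω => (X ω j, U ω j)) μ) :
    HasResidualLaw X U (fun u j => m j (u j)) (Measure.pi ν) μ := by
  have hm (j : ι) := (h j).measurable
  have hpairs := (hind.comp (fun j p => (p.2, p.1 - m j p.2)) fun j => by fun_prop).hasLaw_pi
    fun j => (h j).hasLaw_prodMk
  have hlaw : HasLaw (fun ω => (U ω, fun j => X ω j - m j (U ω j)))
      ((Measure.pi fun j => μ.map fun ω => U ω j).prod (Measure.pi ν)) μ :=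
    (measurePreserving_arrowProdEquivProdArrow F E ι _ ν).fun_comp_hasLaw hpairs
  have hU : HasLaw U (Measure.pi fun j => μ.map fun ω => U ω j) μ :=
    (hind.comp (fun _ p => p.2) fun _ => measurable_snd).hasLaw_pi
      fun j => ⟨(h j).aemeasurable_cond, rfl⟩
  exact ⟨by fun_prop, hU.map_eq ▸ hlaw⟩

section Entropy

variable {Ω F : Type*} [MeasurableSpace Ω] [MeasurableSpace F] {μ : Measure Ω}
  [IsProbabilityMeasure μ] {U : Ω → F}

theorem condDiffEntropy_gaussianReal {X : Ω → ℝ} {m : F → ℝ} {v : ℝ≥0}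
    (h : HasResidualLaw X U m (gaussianReal 0 v) μ) :
    condDiffEntropy X U μ = gaussianEntropy v := by
  obtain rfl | hv := eq_or_ne v 0
  · have hlaw := h.hasLaw
    rw [gaussianReal_zero_var] at hlaw
    rw [gaussianEntropy_zero]
    refine condDiffEntropy_eq_bot_of_comp_ae_eq h.aemeasurable h.aemeasurable_cond measurable_id
      measure_singleton h.measurable ?_
    filter_upwards [hlaw.ae_eq_of_dirac] with ω hω using sub_eq_zero.1 hω
  have hint : Integrable (fun ω => (X ω - m (U ω)) ^ 2 / (2 * v)) μ :=
    (memLp_two_of_hasLaw_gaussianReal h.hasLaw).integrable_sq.div_const _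
  have hlog (ω : Ω) : Real.log (gaussianPDF 0 v (X ω - m (U ω))).toReal
      = -(Real.log (2 * Real.pi * v) / 2) - (X ω - m (U ω)) ^ 2 / (2 * v) := by
    rw [log_toReal_gaussianPDF 0 hv, sub_zero]
  have hdens := hasCondDensity_of_indepFun_sub h.aemeasurable h.aemeasurable_cond h.measurable
    h.indepFun (measurable_gaussianPDF 0 v)
    (h.hasLaw.map_eq.trans (gaussianReal_of_var_ne_zero 0 hv))
  rw [hdens.condDiffEntropy_eq_neg_integral (by
      simpa only [hlog, Pi.sub_def] using (integrable_const _).sub hint),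
    gaussianEntropy_of_ne_zero hv]
  simp only [hlog]
  rw [integral_sub (integrable_const _) hint, integral_div,
    integral_sq_of_hasLaw_gaussianReal h.hasLaw]
  congr 1
  have : (v : ℝ) ≠ 0 := NNReal.coe_ne_zero.2 hv
  simp only [integral_const, probReal_univ, one_smul]
  field_simp
  ring

theorem condDiffEntropy_pi_gaussianReal {ι : Type*} [Fintype ι] [Nonempty ι] {X : Ω → ι → ℝ}
    {m : F → ι → ℝ} {v : ℝ≥0} (h : HasResidualLaw X U m (Measure.pi fun _ => gaussianReal 0 v) μ) :
    condDiffEntropy X U μ = Fintype.card ι * gaussianEntropy v := by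
  have hlaw (j : ι) : HasLaw (fun ω => X ω j - m (U ω) j) (gaussianReal 0 v) μ :=
    hasLaw_eval_of_hasLaw_pi h.hasLaw j
  have hD (j : ι) : MemLp (fun ω => X ω j - m (U ω) j) 2 μ :=
    memLp_two_of_hasLaw_gaussianReal (hlaw j)
  have hsum : ∑ j, ∫ ω, (X ω j - m (U ω) j) ^ 2 ∂μ = Fintype.card ι * v := by
    simp [fun j => integral_sq_of_hasLaw_gaussianReal (hlaw j)]
  obtain rfl | hv := eq_or_ne v 0
  · rw [condDiffEntropy_eq_bot_of_sum_integral_sq_sub_nonpos h.aemeasurable h.aemeasurable_cond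
      h.measurable hD (by simp [hsum]), gaussianEntropy_zero,
      EReal.mul_bot_of_pos (by exact_mod_cast Fintype.card_pos)]
  have hdens := hasCondDensity_of_indepFun_sub h.aemeasurable h.aemeasurable_cond h.measurable
    h.indepFun (measurable_gaussianPiPDF v)
    (h.hasLaw.map_eq.trans (pi_gaussianReal_eq_withDensity hv))
  have hint := integral_log_gaussianPiPDF (D := fun ω => X ω - m (U ω)) hv hD
  rw [hdens.condDiffEntropy_eq_neg_integral (integrable_log_gaussianPiPDF hv hD), hint]
  simp only [Pi.sub_apply, hsum, gaussianEntropy_of_ne_zero hv]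
  have : (v : ℝ) ≠ 0 := NNReal.coe_ne_zero.2 hv
  rw [← EReal.coe_natCast, ← EReal.coe_mul]
  congr 1
  field_simp
  ring

theorem condDiffEntropy_sub_add_gaussian_eq {ι : Type*} [Fintype ι] [Nonempty ι]
    {X Z : Ω → ι → ℝ} {m : F → ι → ℝ} {v s : ℝ≥0}
    (h : HasResidualLaw X U m (Measure.pi fun _ => gaussianReal 0 v) μ)
    (hZ : HasLaw Z (Measure.pi fun _ => gaussianReal 0 s) μ)
    (hind : IndepFun Z (fun ω => (X ω, U ω)) μ) :
    condDiffEntropy X U μ - condDiffEntropy (fun ω => X ω + Z ω) U μ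
      = Fintype.card ι * gaussianEntropy v - Fintype.card ι * gaussianEntropy (v + s) := by
  have hXZ : HasResidualLaw (fun ω => X ω + Z ω) U m
      (Measure.pi fun _ => gaussianReal 0 (v + s)) μ := by
    simpa only [pi_conv_pi, gaussianReal_conv_gaussianReal, add_zero] using h.add_indep hZ hind
  rw [h.condDiffEntropy_pi_gaussianReal, hXZ.condDiffEntropy_pi_gaussianReal]

end Entropy

end HasResidualLaw

theorem AvgPowerConstraint.memLp {Ω : Type*} [MeasurableSpace Ω] {μ : Measure Ω} {n : ℕ}
    {X : Ω → Fin n → ℝ} {P : ℝ≥0} (h : AvgPowerConstraint X P μ) (hX : AEMeasurable X μ)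
    (j : Fin n) : MemLp (fun ω => X ω j) 2 μ := by
  rw [memLp_two_iff_integrable_sq (by fun_prop)]
  refine ⟨by fun_prop, ?_⟩
  rw [hasFiniteIntegral_iff_ofReal (.of_forall fun _ => sq_nonneg _)]
  refine lt_of_le_of_lt ?_ (h.trans_lt (ENNReal.mul_lt_top (by simp) (by simp)))
  exact Finset.single_le_sum (f := fun j => ∫⁻ ω, ENNReal.ofReal (X ω j ^ 2) ∂μ)
    (fun _ _ => zero_le) (Finset.mem_univ j)

section Gaussian

variable {Ω : Type*} [MeasurableSpace Ω] {μ : Measure Ω} {X U Z : Ω → ℝ}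

theorem indepFun_prodMk_of_covariance_eq_zero
    (h : HasGaussianLaw (fun ω => (Z ω, X ω, U ω)) μ) (hZX : cov[Z, X; μ] = 0)
    (hZU : cov[Z, U; μ] = 0) : IndepFun Z (fun ω => (X ω, U ω)) μ := by
  have := h.isProbabilityMeasure
  have hZ := h.fst.memLp_two
  have hX := h.snd.fst.memLp_two
  have hU := h.snd.snd.memLp_two
  refine h.indepFun_of_covariance_strongDual fun L₁ L₂ => ?_
  have hL₁ : L₁ ∘ Z = fun ω => L₁ 1 * Z ω := by
    ext ω
    simpa [mul_comm] using L₁.map_smul (Z ω) 1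
  have hL₂ : L₂ ∘ (fun ω => (X ω, U ω)) = fun ω => L₂ (1, 0) * X ω + L₂ (0, 1) * U ω := by
    ext ω
    have : (X ω, U ω) = X ω • ((1, 0) : ℝ × ℝ) + U ω • ((0, 1) : ℝ × ℝ) := by simp
    rw [Function.comp_apply, this, map_add, map_smul, map_smul]
    simp [mul_comm]
  rw [hL₁, hL₂, ← Pi.add_def, covariance_add_right (hZ.const_mul _) (hX.const_mul _)
    (hU.const_mul _)]
  simp only [covariance_const_mul_left, covariance_const_mul_right, hZX, hZU, mul_zero, add_zero]

variable [IsProbabilityMeasure μ]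

theorem exists_covariance_sub_mul_eq_zero (hX : MemLp X 2 μ) (hU : MemLp U 2 μ) :
    ∃ a : ℝ, cov[fun ω => X ω - a * U ω, U; μ] = 0 := by
  refine ⟨cov[X, U; μ] / Var[U; μ], ?_⟩
  rw [covariance_fun_sub_left hX (hU.const_mul _) hU, covariance_const_mul_left,
    covariance_self hU.aemeasurable]
  obtain hvar | hvar := eq_or_ne Var[U; μ] 0
  · rw [hvar, mul_zero, sub_zero, covariance]
    refine integral_eq_zero_of_ae ?_
    filter_upwards [ae_eq_integral_of_variance_eq_zero hU hvar] with ω hω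
    simp [hω]
  · rw [div_mul_cancel₀ _ hvar, sub_self]

theorem exists_hasResidualLaw_of_hasGaussianLaw (h : HasGaussianLaw (fun ω => (X ω, U ω)) μ) :
    ∃ (a b : ℝ) (v : ℝ≥0), (v : ℝ) = Var[fun ω => X ω - a * U ω; μ] ∧
      HasResidualLaw X U (fun u => a * u + b) (gaussianReal 0 v) μ := by
  have hX := h.fst.memLp_two
  have hU := h.snd.memLp_two
  obtain ⟨a, ha⟩ := exists_covariance_sub_mul_eq_zero hX hU
  have hpair : HasGaussianLaw (fun ω => (U ω, X ω - a * U ω)) μ := by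
    simpa using h.map_fun ((ContinuousLinearMap.snd ℝ ℝ ℝ).prod
      (ContinuousLinearMap.fst ℝ ℝ ℝ - a • ContinuousLinearMap.snd ℝ ℝ ℝ))
  have hind : IndepFun U (fun ω => X ω - a * U ω) μ :=
    hpair.indepFun_of_covariance_eq_zero (by rw [covariance_comm, ha])
  refine ⟨a, ∫ ω, (X ω - a * U ω) ∂μ, Var[fun ω => X ω - a * U ω; μ].toNNReal,
    Real.coe_toNNReal _ (variance_nonneg _ _),
    .of_indepFun hU.aemeasurable (by fun_prop) ?_ ?_⟩
  · simp only [← sub_sub]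
    exact hind.comp measurable_id (measurable_id.sub_const _)
  · have hlaw : HasLaw (fun ω => X ω - a * U ω) _ μ :=
      ⟨hpair.snd.aemeasurable, hpair.snd.map_eq_gaussianReal⟩
    simpa only [← sub_sub, sub_self] using gaussianReal_sub_const hlaw (∫ ω, (X ω - a * U ω) ∂μ)

end Gaussian

section CovarianceMatrix

variable {Ω ι : Type*} [MeasurableSpace Ω] {μ : Measure Ω} {V : Ω → ι → ℝ}

theorem covarianceMatrix_eq_of_hasLaw_multivariateGaussian [Fintype ι] [DecidableEq ι]
    {m : EuclideanSpace ℝ ι} {S : Matrix ι ι ℝ} (hS : S.PosSemidef)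
    (h : HasLaw (fun ω => WithLp.toLp 2 (V ω)) (multivariateGaussian m S) μ) :
    covarianceMatrix V μ = S := by
  ext i k
  rw [← covariance_eval_multivariateGaussian (μ := m) hS i k,
    ← h.covariance_fun_comp (by fun_prop) (by fun_prop)]
  rfl

variable [IsProbabilityMeasure μ]

theorem dotProduct_covarianceMatrix_mulVec [Fintype ι] (hV : ∀ i, MemLp (fun ω => V ω i) 2 μ)
    (x : ι → ℝ) :
    x ⬝ᵥ (covarianceMatrix V μ).mulVec x = Var[fun ω => ∑ i, x i * V ω i; μ] := by
  rw [variance_fun_sum fun i => (hV i).const_mul (x i)]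
  simp only [dotProduct, Matrix.mulVec, covarianceMatrix, Matrix.of_apply, Finset.mul_sum,
    covariance_const_mul_left, covariance_const_mul_right]
  exact Finset.sum_congr rfl fun i _ => Finset.sum_congr rfl fun k _ => by ring

theorem posSemidef_covarianceMatrix [Finite ι] (hV : ∀ i, MemLp (fun ω => V ω i) 2 μ) :
    (covarianceMatrix V μ).PosSemidef := by
  have := Fintype.ofFinite ι
  refine .of_dotProduct_mulVec_nonneg (Matrix.IsHermitian.ext fun i k => covariance_comm _ _)
    fun x => ?_
  rw [star_trivial, dotProduct_covarianceMatrix_mulVec hV]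
  exact variance_nonneg _ _

end CovarianceMatrix

theorem posSemidef_apply_eq_zero {ι : Type*} [Finite ι] {M : Matrix ι ι ℝ} (hM : M.PosSemidef)
    {i : ι} (h : M i i = 0) (k : ι) : M k i = 0 := by
  classical
  have := Fintype.ofFinite ι
  have := (hM.dotProduct_mulVec_zero_iff (Pi.single i 1)).1 (by simp [h])
  simpa using congrFun this k

section CovarianceConstraint

variable {Ω Ω' ι J : Type*} [MeasurableSpace Ω] [MeasurableSpace Ω'] [Fintype J]
  {μ : Measure Ω} {μ' : Measure Ω'} {V : J → Ω → ι → ℝ} {W : Ω' → ι → ℝ} {c : ℝ}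

theorem smul_sum_covariance_eq [Finite ι]
    (h : (covarianceMatrix W μ' - c • ∑ j, covarianceMatrix (V j) μ).PosSemidef) {i : ι}
    (hi : c * ∑ j, cov[fun ω => V j ω i, fun ω => V j ω i; μ]
      = cov[fun ω => W ω i, fun ω => W ω i; μ']) (k : ι) :
    c * ∑ j, cov[fun ω => V j ω k, fun ω => V j ω i; μ]
      = cov[fun ω => W ω k, fun ω => W ω i; μ'] := by
  have := posSemidef_apply_eq_zero h (i := i)
    (by simp [Matrix.sum_apply, covarianceMatrix, hi]) k
  simp only [Matrix.sub_apply, Matrix.smul_apply, Matrix.sum_apply, covarianceMatrix,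
    Matrix.of_apply, smul_eq_mul, sub_eq_zero] at this
  exact this.symm

variable [IsProbabilityMeasure μ]

theorem posSemidef_of_sub_smul_sum_covarianceMatrix [Finite ι]
    (hV : ∀ j i, MemLp (fun ω => V j ω i) 2 μ) (hc : 0 ≤ c) {K : Matrix ι ι ℝ}
    (hK : (K - c • ∑ j, covarianceMatrix (V j) μ).PosSemidef) : K.PosSemidef := by
  have hsum := Matrix.posSemidef_sum Finset.univ fun j _ => posSemidef_covarianceMatrix (hV j)
  simpa using hK.add (hsum.smul hc)

theorem smul_sum_variance_le [Fintype ι] [IsProbabilityMeasure μ']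
    (hV : ∀ j i, MemLp (fun ω => V j ω i) 2 μ)
    (hW : ∀ i, MemLp (fun ω => W ω i) 2 μ')
    (h : (covarianceMatrix W μ' - c • ∑ j, covarianceMatrix (V j) μ).PosSemidef) (x : ι → ℝ) :
    c * ∑ j, Var[fun ω => ∑ i, x i * V j ω i; μ] ≤ Var[fun ω => ∑ i, x i * W ω i; μ'] := by
  have hx := h.dotProduct_mulVec_nonneg x
  rw [star_trivial, Matrix.sub_mulVec, Matrix.smul_mulVec, Matrix.sum_mulVec, dotProduct_sub,
    dotProduct_smul, dotProduct_sum, dotProduct_covarianceMatrix_mulVec hW, sub_nonneg] at hx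
  simpa only [dotProduct_covarianceMatrix_mulVec (hV _), smul_eq_mul] using hx

end CovarianceConstraint

theorem memLp_vecCons_three {Ω E : Type*} [MeasurableSpace Ω] [NormedAddCommGroup E]
    {μ : Measure Ω} {p : ℝ≥0∞} {A B C : Ω → E} (hA : MemLp A p μ) (hB : MemLp B p μ)
    (hC : MemLp C p μ) (i : Fin 3) : MemLp (fun ω => ![A ω, B ω, C ω] i) p μ := by
  fin_cases i
  exacts [hA, hB, hC]

theorem hasGaussianLaw_prodMk_of_hasGaussianLaw_add {Ω : Type*} [MeasurableSpace Ω] {μ : Measure Ω}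
    {X U Z : Ω → ℝ}
    (h : HasGaussianLaw (fun ω => !₂[Z ω, X ω + Z ω, U ω]) μ) :
    HasGaussianLaw (fun ω => (Z ω, X ω, U ω)) μ := by
  let π (i : Fin 3) : EuclideanSpace ℝ (Fin 3) →L[ℝ] ℝ := EuclideanSpace.proj i
  simpa [π] using h.map_fun ((π 0).prod ((π 1 - π 0).prod (π 2)))

section NoiseCovariance

variable {Ω Ω' J : Type*} [MeasurableSpace Ω] [MeasurableSpace Ω'] [Fintype J]
  {μ : Measure Ω} [IsProbabilityMeasure μ] {μ' : Measure Ω'} [IsProbabilityMeasure μ']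
  {X U Z : Ω → J → ℝ} {Xg Ug Zg : Ω' → ℝ} {c : ℝ}

theorem indepFun_noise_of_posSemidef_sub
    (hG : HasGaussianLaw (fun ω => (Zg ω, Xg ω, Ug ω)) μ')
    (hX : ∀ j, MemLp (fun ω => X ω j) 2 μ) (hZ : ∀ j, MemLp (fun ω => Z ω j) 2 μ)
    (hXZ : ∀ j, cov[fun ω => X ω j, fun ω => Z ω j; μ] = 0)
    (hUZ : ∀ j, cov[fun ω => U ω j, fun ω => Z ω j; μ] = 0)
    (hvar : c * ∑ j, Var[fun ω => Z ω j; μ] = Var[Zg; μ'])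
    (h : (covarianceMatrix (fun ω => ![Zg ω, Xg ω + Zg ω, Ug ω]) μ' -
      c • ∑ j, covarianceMatrix (fun ω => ![Z ω j, X ω j + Z ω j, U ω j]) μ).PosSemidef) :
    IndepFun Zg (fun ω => (Xg ω, Ug ω)) μ' := by
  have hZg := hG.fst.memLp_two
  have hXg := hG.snd.fst.memLp_two
  have hXZj (j) : cov[fun ω => X ω j + Z ω j, fun ω => Z ω j; μ] = Var[fun ω => Z ω j; μ] := by
    rw [← Pi.add_def, covariance_add_left (hX j) (hZ j) (hZ j), hXZ j, zero_add,
      covariance_self (hZ j).aemeasurable]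
  have hXZg : cov[fun ω => Xg ω + Zg ω, Zg; μ'] = cov[Xg, Zg; μ'] + Var[Zg; μ'] := by
    rw [← Pi.add_def, covariance_add_left hXg hZg hZg, covariance_self hZg.aemeasurable]
  have hcol := smul_sum_covariance_eq h (i := 0) (by
    simpa [covariance_self, (hZ _).aemeasurable, hZg.aemeasurable] using hvar)
  have hcol1 := hcol 1
  have hcol2 := hcol 2
  simp only [Matrix.cons_val_zero, Matrix.cons_val_one, Matrix.cons_val, hXZj, hXZg, hUZ, hvar,
    Finset.sum_const_zero, mul_zero] at hcol1 hcol2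
  apply indepFun_prodMk_of_covariance_eq_zero hG
  · rw [covariance_comm]
    linarith
  · rw [covariance_comm, ← hcol2]

theorem smul_sum_variance_sub_mul_le
    (hX : ∀ j, MemLp (fun ω => X ω j) 2 μ) (hU : ∀ j, MemLp (fun ω => U ω j) 2 μ)
    (hZ : ∀ j, MemLp (fun ω => Z ω j) 2 μ)
    (hXg : MemLp Xg 2 μ') (hUg : MemLp Ug 2 μ') (hZg : MemLp Zg 2 μ')
    (h : (covarianceMatrix (fun ω => ![Zg ω, Xg ω + Zg ω, Ug ω]) μ' -
      c • ∑ j, covarianceMatrix (fun ω => ![Z ω j, X ω j + Z ω j, U ω j]) μ).PosSemidef) (a : ℝ) :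
    c * ∑ j, Var[fun ω => X ω j - a * U ω j; μ] ≤ Var[fun ω => Xg ω - a * Ug ω; μ'] := by
  have hform (z x u : ℝ) : ∑ i, ![-1, 1, -a] i * ![z, x + z, u] i = x - a * u := by
    simp [Fin.sum_univ_three]
    ring
  simpa only [Pi.add_apply, hform] using smul_sum_variance_le
    (fun j => memLp_vecCons_three (hZ j) ((hX j).add (hZ j)) (hU j))
    (memLp_vecCons_three hZg (hXg.add hZg) hUg) h ![-1, 1, -a]

theorem exists_hasResidualLaw_of_posSemidef_sub [Nonempty J] {s : ℝ≥0}
    (hX : ∀ j, MemLp (fun ω => X ω j) 2 μ) (hU : ∀ j, MemLp (fun ω => U ω j) 2 μ)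
    (hZ : ∀ j, HasLaw (fun ω => Z ω j) (gaussianReal 0 s) μ)
    (hind : IndepFun Z (fun ω => (X ω, U ω)) μ)
    (hG : HasGaussianLaw (fun ω => (Zg ω, Xg ω, Ug ω)) μ') (hZg : HasLaw Zg (gaussianReal 0 s) μ')
    (h : (covarianceMatrix (fun ω => ![Zg ω, Xg ω + Zg ω, Ug ω]) μ' - (Fintype.card J : ℝ)⁻¹ •
      ∑ j, covarianceMatrix (fun ω => ![Z ω j, X ω j + Z ω j, U ω j]) μ).PosSemidef) :
    ∃ (a b : ℝ) (v : ℝ≥0),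
      HasResidualLaw Xg Ug (fun u => a * u + b) (gaussianReal 0 v) μ' ∧
      HasResidualLaw (fun ω => Xg ω + Zg ω) Ug (fun u => a * u + b) (gaussianReal 0 (v + s)) μ' ∧
      ∑ j, Var[fun ω => X ω j - a * U ω j; μ] ≤ Fintype.card J * v := by
  have hZ2 (j) := memLp_two_of_hasLaw_gaussianReal (hZ j)
  have hXZ (j) : IndepFun (fun ω => X ω j) (fun ω => Z ω j) μ :=
    hind.symm.comp ((measurable_pi_apply j).comp measurable_fst) (measurable_pi_apply j)
  have hUZ (j) : IndepFun (fun ω => U ω j) (fun ω => Z ω j) μ :=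
    hind.symm.comp ((measurable_pi_apply j).comp measurable_snd) (measurable_pi_apply j)
  have hvar : (Fintype.card J : ℝ)⁻¹ * ∑ j, Var[fun ω => Z ω j; μ] = Var[Zg; μ'] := by
    simp [fun j => (hZ j).variance_eq, hZg.variance_eq]
  have hindg : IndepFun Zg (fun ω => (Xg ω, Ug ω)) μ' :=
    indepFun_noise_of_posSemidef_sub hG hX hZ2
      (fun j => (hXZ j).covariance_eq_zero (hX j) (hZ2 j))
      (fun j => (hUZ j).covariance_eq_zero (hU j) (hZ2 j)) hvar h
  obtain ⟨a, b, v, hv, hres⟩ := exists_hasResidualLaw_of_hasGaussianLaw hG.snd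
  refine ⟨a, b, v, hres, ?_, ?_⟩
  · simpa only [gaussianReal_conv_gaussianReal, add_zero] using hres.add_indep hZg hindg
  · have hle := smul_sum_variance_sub_mul_le hX hU hZ2 hG.snd.fst.memLp_two
      hG.snd.snd.memLp_two hG.fst.memLp_two h a
    rwa [← hv, inv_mul_le_iff₀ (by exact_mod_cast Fintype.card_pos)] at hle

end NoiseCovariance

theorem condDiffEntropy_sub_add_gaussian_le_of_sum_variance_le {Ω ι : Type*} [MeasurableSpace Ω]
    [Fintype ι] [Nonempty ι] {μ : Measure Ω} [IsProbabilityMeasure μ] {X U Z : Ω → ι → ℝ}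
    {s v : ℝ≥0} (hX : ∀ j, MemLp (fun ω => X ω j) 2 μ) (hU : ∀ j, MemLp (fun ω => U ω j) 2 μ)
    (hZ : HasLaw Z (Measure.pi fun _ => gaussianReal 0 s) μ)
    (hind : IndepFun Z (fun ω => (X ω, U ω)) μ) (a : ℝ)
    (hle : ∑ j, Var[fun ω => X ω j - a * U ω j; μ] ≤ Fintype.card ι * v) :
    condDiffEntropy X U μ - condDiffEntropy (fun ω => X ω + Z ω) U μ
      ≤ Fintype.card ι * gaussianEntropy v - Fintype.card ι * gaussianEntropy (v + s) := by
  have hD (j) : MemLp (fun ω => X ω j - a * U ω j) 2 μ := (hX j).sub ((hU j).const_mul a)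
  refine condDiffEntropy_sub_add_gaussian_le
    (aemeasurable_pi_lambda _ fun j => (hX j).aemeasurable)
    (aemeasurable_pi_lambda _ fun j => (hU j).aemeasurable) hZ hind
    (m := fun u j => a * u j + ∫ ω, (X ω j - a * U ω j) ∂μ) (by fun_prop) (fun j => ?_) ?_
  · simp only [← sub_sub]
    exact (hD j).sub (memLp_const _)
  · simpa only [← sub_sub, ← fun j => variance_eq_integral (hD j).aemeasurable] using hle

theorem mainTheorem4
    {Ω Ω' : Type*} [MeasurableSpace Ω] [MeasurableSpace Ω']
    (μ : Measure Ω) [IsProbabilityMeasure μ] (μ' : Measure Ω') [IsProbabilityMeasure μ']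
    (n : ℕ) (hn : 0 < n)
    -- the random sequences `X^n`, `U^n` (arbitrarily dependent) and the noise `Z^n`
    (X U Z : Ω → Fin n → ℝ) (hX : Measurable X) (hU : Measurable U) (hZ : Measurable Z)
    (PX PU : ℝ≥0) (hPX : AvgPowerConstraint X PX μ) (hPU : AvgPowerConstraint U PU μ)
    -- `Z^n` is i.i.d. `N(0, σ²)` and independent of `(X^n, U^n)`
    (σsq : ℝ≥0)
    (hZlaw : ∀ j, HasLaw (fun ω => Z ω j) (gaussianReal 0 σsq) μ)
    (hZiid : iIndepFun (fun (j : Fin n) (ω : Ω) => Z ω j) μ)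
    (hZXU : IndepFun Z (fun ω => (X ω, U ω)) μ)
    -- the average covariance constraint
    (K : Matrix (Fin 3) (Fin 3) ℝ)
    (hK : (K - (n : ℝ)⁻¹ •
      ∑ j, covarianceMatrix (fun ω => ![Z ω j, X ω j + Z ω j, U ω j]) μ).PosSemidef)
    -- the Gaussian vector `(Z, X_g + Z, U_g)` with covariance `K`, where `Z` is again `N(0, σ²)`
    (Zg Xg Ug : Ω' → ℝ)
    (hg : HasLaw (fun ω => !₂[Zg ω, Xg ω + Zg ω, Ug ω]) (multivariateGaussian 0 K) μ')
    (hZg : HasLaw Zg (gaussianReal 0 σsq) μ') :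
    -- the entropies are smaller than `∞`, and the subtracted ones are finite for proper noise
    (condDiffEntropy X U μ < ⊤ ∧ condDiffEntropy (fun ω => X ω + Z ω) U μ < ⊤ ∧
      condDiffEntropy Xg Ug μ' < ⊤ ∧ condDiffEntropy (fun ω => Xg ω + Zg ω) Ug μ' < ⊤) ∧
    (0 < σsq → ⊥ < condDiffEntropy (fun ω => X ω + Z ω) U μ ∧
      ⊥ < condDiffEntropy (fun ω => Xg ω + Zg ω) Ug μ') ∧
    -- the inequality
    condDiffEntropy X U μ - condDiffEntropy (fun ω => X ω + Z ω) U μ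
      ≤ (n : EReal) * condDiffEntropy Xg Ug μ'
        - (n : EReal) * condDiffEntropy (fun ω => Xg ω + Zg ω) Ug μ' ∧
    -- equality if the pairs `(X_j, U_j)` are i.i.d. copies of `(X_g, U_g)`
    (iIndepFun (fun (j : Fin n) (ω : Ω) => (X ω j, U ω j)) μ →
      (∀ j, IdentDistrib (fun ω => (X ω j, U ω j)) (fun ω => (Xg ω, Ug ω)) μ μ') →
      condDiffEntropy X U μ - condDiffEntropy (fun ω => X ω + Z ω) U μ
        = (n : EReal) * condDiffEntropy Xg Ug μ'
          - (n : EReal) * condDiffEntropy (fun ω => Xg ω + Zg ω) Ug μ') := by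
  have hX2 := hPX.memLp hX.aemeasurable
  have hU2 := hPU.memLp hU.aemeasurable
  have hY2 (j) : MemLp (fun ω => X ω j + Z ω j) 2 μ :=
    (hX2 j).add (memLp_two_of_hasLaw_gaussianReal (hZlaw j))
  have hZpi := hZiid.hasLaw_pi hZlaw
  have hKpsd : K.PosSemidef := posSemidef_of_sub_smul_sum_covarianceMatrix
    (fun j => memLp_vecCons_three (memLp_two_of_hasLaw_gaussianReal (hZlaw j)) (hY2 j) (hU2 j))
    (by positivity) hK
  have : Nonempty (Fin n) := Fin.pos_iff_nonempty.1 hn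
  rw [← covarianceMatrix_eq_of_hasLaw_multivariateGaussian hKpsd hg] at hK
  obtain ⟨a, b, v, hXg, hYg, hle⟩ := exists_hasResidualLaw_of_posSemidef_sub hX2 hU2 hZlaw hZXU
    (hasGaussianLaw_prodMk_of_hasGaussianLaw_add hg.hasGaussianLaw) hZg
    (by simpa only [Fintype.card_fin] using hK)
  rw [hXg.condDiffEntropy_gaussianReal, hYg.condDiffEntropy_gaussianReal]
  refine ⟨⟨condDiffEntropy_lt_top_of_memLp hX2 hU.aemeasurable,
    condDiffEntropy_lt_top_of_memLp hY2 hU.aemeasurable, gaussianEntropy_lt_top _,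
    gaussianEntropy_lt_top _⟩, fun hσ => ⟨bot_lt_condDiffEntropy_add_gaussian hX.aemeasurable
      hU.aemeasurable hσ.ne' hZpi hZXU, bot_lt_gaussianEntropy (by positivity)⟩,
    by simpa only [Fintype.card_fin] using
      condDiffEntropy_sub_add_gaussian_le_of_sum_variance_le hX2 hU2 hZpi hZXU a hle,
    fun hi hd => ?_⟩
  have hXU : HasResidualLaw X U _ _ μ := .pi (fun j => hXg.of_identDistrib (hd j).symm) hi
  simpa only [Fintype.card_fin] using hXU.condDiffEntropy_sub_add_gaussian_eq hZpi hZXU
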